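/- Setting. Let $\kappa,m,r$ be the horizon and the dimensions, $A\in\mathbb R^{m\times m}$, $B\in\mathbb R^{m\times r}$, $\Sigma_1,\Sigma_w\in\mathbb R^{m\times m}$ positive semi-definite, $\Omega$ a finite set of attacker types, and $\Omega^o=\Omega\cup\{\omega_o\}$, where $\omega_o\notin\Omega$ stands for the controller of the system. For every $\omega\in\Omega^o$ let $Q^\omega\in\mathbb R^{m\times m}$ be positive semi-definite and $R^\omega\in\mathbb R^{r\times r}$ positive definite. Write $\|x\|_W^2=x'Wx$. The state evolves as $x_{k+1}=Ax_k+Bu_k+w_k$, $k=1,\dots,\kappa$, with $x_1\sim\mathcal N(0,\Sigma_1)$ and $w_k\sim\mathcal N(0,\Sigma_w)$. The sensor observes the state perfectly and picks a linear-plus-noise signaling rule $\eta\in\Upsilon$, that is, arbitrary $L_{k,j}\in\mathbb R^{m\times m}$ ($j\le k$) and positive semi-definite $\Theta_k$, which yields $s_k=\sum_{j\le k}L_{k,j}'x_j+\vartheta_k$ with $\vartheta_k\sim\mathcal N(0,\Theta_k)$; here $x_1,w_1,\dots,w_\kappa,\vartheta_1,\dots,\vartheta_\kappa$ are mutually independent.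 A control policy $\gamma\in\Gamma$ consists of arbitrary Borel functions, $u_k=\gamma_k(s_{1:k})$. Denote by $x_k^\omega,u_k^\omega$ the state and control when type $\omega$ drives the system with its policy $\gamma^\omega$. Type $\omega\in\Omega^o$ minimizes $U_C^\omega(\eta,\gamma^\omega)=\sum_{k=1}^\kappa\big(\mathbb E\|x^\omega_{k+1}\|^2_{Q^\omega}+\mathbb E\|u^\omega_k\|^2_{R^\omega}\big)$ over $\Gamma$, given $\eta$; its minimizers are its best responses. The sensor's objective is $$U_S(\eta,\{\gamma^\omega\})=\max_{p\in\Delta(\Omega^o)}\Big\{\sum_{\omega\in\Omega}p_\omega\sum_{k=1}^\kappa\mathbb E\|x_{k+1}^\omega\|^2_{Q^{\omega_o}}+p_{\omega_o}\sum_{k=1}^\kappa\big(\mathbb E\|x_{k+1}^{\omega_o}\|^2_{Q^{\omega_o}}+\mathbb E\|u_k^{\omega_o}\|^2_{R^{\omega_o}}\big)\Big\},$$ where $\Delta(\Omega^o)$ is the set of probability distributions on $\Omega^o$. Notation. Let $x^o_1=x_1$, $x^o_{k+1}=Ax^o_k+w_k$ be the control-free state, and $H_k=\mathrm{cov}\{\mathbb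 E\{x_k^o\mid s_{1:k}\}\}$. Let $\tilde Q^\omega_{\kappa+1}=Q^\omega$, $\Delta_k^\omega=B'\tilde Q^\omega_{k+1}B+R^\omega$, $\tilde Q_k^\omega=Q^\omega+A'\big(\tilde Q^\omega_{k+1}-\tilde Q^\omega_{k+1}B(\Delta^\omega_k)^{-1}B'\tilde Q^\omega_{k+1}\big)A$, $K_k^\omega=(\Delta_k^\omega)^{-1}B'\tilde Q_{k+1}^\omega A$, $\delta_0^\omega=\mathrm{Tr}\{(\tilde Q_1^\omega-Q^\omega)\Sigma_1\}+\sum_{k=1}^\kappa\mathrm{Tr}\{\tilde Q^\omega_{k+1}\Sigma_w\}$, and, for a policy with controls $u_k$, $u_k^o=u_k+\sum_{j<k}K_k^\omega A^{k-1-j}Bu_j$. Consider $\kappa\times\kappa$ block matrices whose block $(k,l)$ refers to the stages $k,l$: $\Phi^\omega$ has the blocks $I$ for $l=k$, $K_k^\omega A^{k-l-1}B$ for $l<k$, and $0$ for $l>k$; $Z$ has the blocks $A^{k-l}B$ for $l\le k$ and $0$ for $l>k$; $K^\omega$ and $\Delta^\omega$ are block diagonal with blocks $K_k^\omega$ and $\Delta_k^\omega$;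 $\bar A=I_\kappa\otimes A$, $\bar Q=I_\kappa\otimes Q^{\omega_o}$, $T^\omega=Z(\Phi^\omega)^{-1}K^\omega$; $\Sigma^o$ has the blocks $\mathbb E\{x^o_k(x^o_l)'\}$. Put $$V^{\omega_o}=-(K^{\omega_o})'\Delta^{\omega_o}K^{\omega_o},\qquad V^\omega=(T^\omega)'\bar QT^\omega-(T^\omega)'\bar Q\bar A-\bar A'\bar QT^\omega\quad(\omega\in\Omega),$$ $$\Xi_k^\omega=V_{k,k}^\omega+\sum_{l=k+1}^{\kappa}\big(V_{k,l}^\omega A^{l-k}+(A^{l-k})'V_{l,k}^\omega\big)\quad(\omega\in\Omega^o),$$ $$\xi^{\omega_o}=\delta_0^{\omega_o}-\mathrm{Tr}\{\Sigma^o\,\mathrm{diag}(\Xi^{\omega_o}_1,\dots,\Xi^{\omega_o}_\kappa)\},\qquad \xi^\omega=\mathrm{Tr}\{\Sigma^o\bar A'\bar Q\bar A\}+\kappa\,\mathrm{Tr}\{\Sigma_wQ^{\omega_o}\}\quad(\omega\in\Omega).$$ Statement. The matrices $\Xi_k^\omega$ are symmetric, and $H_k$ depends on $\eta$ only, not on the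 control policy. For every $\eta\in\Upsilon$ and $\omega\in\Omega^o$ best responses exist, and they are exactly the policies with $u_k^o=-K_k^\omega\,\mathbb E\{x_k^o\mid s_{1:k}\}$ almost surely for $k=1,\dots,\kappa$. For every choice $\eta\mapsto\{\gamma^\omega(\eta)\}_{\omega\in\Omega^o}$ of best responses and every $\eta\in\Upsilon$, $$U_S\big(\eta,\{\gamma^\omega(\eta)\}\big)=\max_{p\in\Delta(\Omega^o)}\sum_{\omega\in\Omega^o}p_\omega\Big(\xi^\omega+\sum_{k=1}^\kappa\mathrm{Tr}\{H_k\Xi_k^\omega\}\Big),$$ the two expressions that are maximized being equal for every $p$. Hence the sensor's problem of minimizing $U_S(\eta,\{\gamma^\omega(\eta)\})$ over $\eta\in\Upsilon$ is the problem $$\min_{\eta\in\Upsilon}\max_{p\in\Delta(\Omega^o)}\sum_{\omega\in\Omega^o}p_\omega\Big(\xi^\omega+\sum_{k=1}^\kappa\mathrm{Tr}\{H_k\Xi_k^\omega\}\Big):$$ both have the same value (infimum over $\eta$) and the same minimizers. -/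

import Mathlib

open MeasureTheory ProbabilityTheory
open scoped Matrix Kronecker ENNReal

noncomputable section

namespace RobustSensor

/-- Parameters of the control problem with horizon `κ`, states in `ℝ^m`, controls in `ℝ^r`.
The extended type set is `Option Ω`: `none` is the controller of the system, `some ω` is the
attacker of type `ω`. `Q ω`, `R ω` are the weights of the objective of type `ω`. -/
structure Model (κ m r : ℕ) (Ω : Type*) where
  A : Matrix (Fin m) (Fin m) ℝ
  B : Matrix (Fin m) (Fin r) ℝ
  covInit : Matrix (Fin m) (Fin m) ℝ
  covNoise : Matrix (Fin m) (Fin m) ℝ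
  Q : Option Ω → Matrix (Fin m) (Fin m) ℝ
  R : Option Ω → Matrix (Fin r) (Fin r) ℝ
  covInit_posSemidef : covInit.PosSemidef
  covNoise_posSemidef : covNoise.PosSemidef
  Q_posSemidef : ∀ ω, (Q ω).PosSemidef
  R_posDef : ∀ ω, (R ω).PosDef

/-- A linear-plus-noise signaling rule under perfect measurements: at stage `k` an arbitrary gain
matrix, given by its blocks `L_{k,j}` for `j ≤ k`, and an arbitrary positive semi-definite
covariance of the additive signaling noise. Stages `1, …, κ` are indexed by `Fin κ`. -/
structure Signaling (κ m : ℕ) where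
  gain : (k : Fin κ) → Finset.Iic k → Matrix (Fin m) (Fin m) ℝ
  noiseCov : Fin κ → Matrix (Fin m) (Fin m) ℝ
  noiseCov_posSemidef : ∀ k, (noiseCov k).PosSemidef

/-- A control policy: at stage `k` an arbitrary Borel function of the signals up to stage `k`. -/
structure Policy (κ m r : ℕ) where
  act : (k : Fin κ) → (Finset.Iic k → Fin m → ℝ) → Fin r → ℝ
  measurable_act : ∀ k, Measurable (act k)

/-- The primitive random vectors: initial state, state noise and, for every signaling rule, the
signaling noise. They are Gaussian with the prescribed laws and mutually independent. -/
structure Noise {κ m r : ℕ} {Ω : Type*} (M : Model κ m r Ω) {S : Type*} [MeasurableSpace S]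
    (P : Measure S) where
  x₁ : S → Fin m → ℝ
  w : Fin κ → S → Fin m → ℝ
  v : Signaling κ m → Fin κ → S → Fin m → ℝ
  measurable_x₁ : Measurable x₁
  measurable_w : ∀ k, Measurable (w k)
  measurable_v : ∀ η k, Measurable (v η k)
  law_x₁ : HasLaw (fun s => WithLp.toLp 2 (x₁ s)) (multivariateGaussian 0 M.covInit) P
  law_w : ∀ k, HasLaw (fun s => WithLp.toLp 2 (w k s)) (multivariateGaussian 0 M.covNoise) P
  law_v : ∀ η k,
    HasLaw (fun s => WithLp.toLp 2 (v η k s)) (multivariateGaussian 0 (η.noiseCov k)) P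
  indep : ∀ η,
    iIndepFun (Sum.elim (fun _ : Unit => x₁) (Sum.elim w (v η)) :
      Unit ⊕ (Fin κ ⊕ Fin κ) → S → Fin m → ℝ) P

/-- The quadratic form `‖x‖_W² = x' W x`. -/
def quad {n : ℕ} (W : Matrix (Fin n) (Fin n) ℝ) (x : Fin n → ℝ) : ℝ := x ⬝ᵥ (W *ᵥ x)

/-! ### Closed-loop and control-free trajectories -/

section Trajectories

variable {κ m r : ℕ} {Ω : Type*} {M : Model κ m r Ω} {S : Type*} [MeasurableSpace S]
  {P : Measure S}

/-- The closed-loop state: `x_{k+1} = A x_k + B γ_k(s_{1:k}) + w_k`, where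
`s_j = ∑_{i ≤ j} L_{j,i}' x_i + ϑ_j`. The index `t : Fin (κ + 1)` is the time `t + 1`. -/
def Noise.state (N : Noise M P) (η : Signaling κ m) (γ : Policy κ m r) :
    Fin (κ + 1) → S → Fin m → ℝ
  | ⟨0, _⟩, s => N.x₁ s
  | ⟨t + 1, h⟩, s =>
      M.A *ᵥ N.state η γ ⟨t, by omega⟩ s
        + M.B *ᵥ γ.act ⟨t, by omega⟩ (fun j =>
            ∑ i : Finset.Iic j.1, (η.gain j.1 i)ᵀ *ᵥ N.state η γ i.1.castSucc s + N.v η j.1 s)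
        + N.w ⟨t, by omega⟩ s
  termination_by t => t.val
  decreasing_by
    · simp
    · have h1 := Finset.mem_Iic.mp i.2
      have h2 := Finset.mem_Iic.mp j.2
      have h3 := Fin.le_def.mp (h1.trans h2)
      simp at h3 ⊢
      omega

/-- The signal `s_k`. -/
def Noise.signal (N : Noise M P) (η : Signaling κ m) (γ : Policy κ m r) (k : Fin κ) (s : S) :
    Fin m → ℝ :=
  ∑ i : Finset.Iic k, (η.gain k i)ᵀ *ᵥ N.state η γ i.1.castSucc s + N.v η k s

/-- The signals `s_{1:k}`. -/
def Noise.signals (N : Noise M P) (η : Signaling κ m) (γ : Policy κ m r) (k : Fin κ) (s : S) :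
    Finset.Iic k → Fin m → ℝ :=
  fun j => N.signal η γ j.1 s

/-- The control input `u_k = γ_k(s_{1:k})`. -/
def Noise.control (N : Noise M P) (η : Signaling κ m) (γ : Policy κ m r) (k : Fin κ) (s : S) :
    Fin r → ℝ :=
  γ.act k (N.signals η γ k s)

/-- The control-free state: `x°_1 = x_1`, `x°_{k+1} = A x°_k + w_k`. -/
def Noise.freeState (N : Noise M P) : Fin (κ + 1) → S → Fin m → ℝ
  | ⟨0, _⟩, s => N.x₁ s
  | ⟨t + 1, h⟩, s => M.A *ᵥ N.freeState ⟨t, by omega⟩ s + N.w ⟨t, by omega⟩ s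
  termination_by t => t.val

/-- The control-free signals `s°_{1:k}`, with `s°_j = ∑_{i ≤ j} L_{j,i}' x°_i + ϑ_j`. -/
def Noise.freeSignals (N : Noise M P) (η : Signaling κ m) (k : Fin κ) (s : S) :
    Finset.Iic k → Fin m → ℝ :=
  fun j => ∑ i : Finset.Iic j.1, (η.gain j.1 i)ᵀ *ᵥ N.freeState i.1.castSucc s + N.v η j.1 s

/-- The posterior estimate `E{x°_k | s_{1:k}}`. -/
def Noise.posterior (N : Noise M P) (η : Signaling κ m) (γ : Policy κ m r) (k : Fin κ) :
    S → Fin m → ℝ :=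
  P[N.freeState k.castSucc | MeasurableSpace.comap (N.signals η γ k) inferInstance]

/-- The covariance matrix of a random vector. -/
def covMat (P : Measure S) {n : ℕ} (X : S → Fin n → ℝ) : Matrix (Fin n) (Fin n) ℝ :=
  Matrix.of fun i j => cov[fun s => X s i, fun s => X s j; P]

/-- `cov{E{x°_k | s_{1:k}}}` in closed loop, with the control policy `γ`. -/
def Noise.posteriorCov (N : Noise M P) (η : Signaling κ m) (γ : Policy κ m r) (k : Fin κ) :
    Matrix (Fin m) (Fin m) ℝ :=
  covMat P (N.posterior η γ k)

/-- `H_k` as a function of the signaling rule alone: `cov{E{x°_k | s°_{1:k}}}`. -/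
def Noise.H (N : Noise M P) (η : Signaling κ m) (k : Fin κ) : Matrix (Fin m) (Fin m) ℝ :=
  covMat P (P[N.freeState k.castSucc | MeasurableSpace.comap (N.freeSignals η k) inferInstance])

/-! ### Objectives, with values in `[0, ∞]` since policies are arbitrary Borel functions -/

/-- The objective of the type-`ω` controller:
`∑_k E‖x_{k+1}‖²_{Q^ω} + E‖u_k‖²_{R^ω}`. -/
def Noise.controllerCost (N : Noise M P) (ω : Option Ω) (η : Signaling κ m) (γ : Policy κ m r) :
    ℝ≥0∞ :=
  ∑ k : Fin κ, ((∫⁻ s, ENNReal.ofReal (quad (M.Q ω) (N.state η γ k.succ s)) ∂P)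
    + ∫⁻ s, ENNReal.ofReal (quad (M.R ω) (N.control η γ k s)) ∂P)

/-- `γ ∈ argmin U_C^ω(η, ·)`. -/
def Noise.IsBestResponse (N : Noise M P) (ω : Option Ω) (η : Signaling κ m)
    (γ : Policy κ m r) : Prop :=
  ∀ γ' : Policy κ m r, N.controllerCost ω η γ ≤ N.controllerCost ω η γ'

/-- The cost to the sensor when type `ω` drives the system with `γ`: the system's own objective
for `ω = none`, and only its state part `∑_k E‖x_{k+1}‖²_{Q}` (with the system's weight) for an
attacker. -/
def Noise.sensorCost (N : Noise M P) (ω : Option Ω) (η : Signaling κ m) (γ : Policy κ m r) :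
    ℝ≥0∞ :=
  match ω with
  | none => N.controllerCost none η γ
  | some _ => ∑ k : Fin κ, ∫⁻ s, ENNReal.ofReal (quad (M.Q none) (N.state η γ k.succ s)) ∂P

/-- The expected cost to the sensor under the distribution `p` over the types. -/
def Noise.sensorMean [Fintype Ω] (N : Noise M P) (η : Signaling κ m)
    (γ : Option Ω → Policy κ m r) (p : Option Ω → ℝ) : ℝ≥0∞ :=
  ∑ ω, ENNReal.ofReal (p ω) * N.sensorCost ω η (γ ω)

/-- The sensor's objective `U_S`: the worst case over all distributions on the types. -/
def Noise.sensorObjective [Fintype Ω] (N : Noise M P) (η : Signaling κ m)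
    (γ : Option Ω → Policy κ m r) : ℝ≥0∞ :=
  ⨆ p : stdSimplex ℝ (Option Ω), N.sensorMean η γ p

end Trajectories

/-! ### The fixed matrices and scalars

Block matrices are indexed by `Fin κ × Fin m`, the first component being the stage; the block
`(k, l)` of such a matrix refers to the stages `k`, `l`. -/

section Parameters

variable {κ m r : ℕ} {Ω : Type*} (M : Model κ m r Ω)

/-- The backward Riccati recursion, started from `Q^ω` and iterated `n` times. -/
def Model.riccati (M : Model κ m r Ω) (ω : Option Ω) : ℕ → Matrix (Fin m) (Fin m) ℝ
  | 0 => M.Q ω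
  | n + 1 =>
      M.Q ω + M.Aᵀ * (M.riccati ω n - M.riccati ω n * M.B
        * (M.Bᵀ * M.riccati ω n * M.B + M.R ω)⁻¹ * M.Bᵀ * M.riccati ω n) * M.A

/-- `Q̃^ω` at time `t + 1`, for `t = 0, …, κ`; it equals `Q^ω` at time `κ + 1`. -/
def Model.Qt (ω : Option Ω) (t : ℕ) : Matrix (Fin m) (Fin m) ℝ := M.riccati ω (κ - t)

/-- `Δ_k^ω = B' Q̃_{k+1}^ω B + R^ω`. -/
def Model.Del (ω : Option Ω) (k : Fin κ) : Matrix (Fin r) (Fin r) ℝ :=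
  M.Bᵀ * M.Qt ω (k + 1) * M.B + M.R ω

/-- `K_k^ω = (Δ_k^ω)⁻¹ B' Q̃_{k+1}^ω A`. -/
def Model.K (ω : Option Ω) (k : Fin κ) : Matrix (Fin r) (Fin m) ℝ :=
  (M.Del ω k)⁻¹ * M.Bᵀ * M.Qt ω (k + 1) * M.A

/-- `δ_0^ω = Tr{(Q̃_1^ω - Q^ω) Σ_1} + ∑_k Tr{Q̃_{k+1}^ω Σ_w}`. -/
def Model.del0 (ω : Option Ω) : ℝ :=
  ((M.Qt ω 0 - M.Q ω) * M.covInit).trace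
    + ∑ k : Fin κ, (M.Qt ω (k + 1) * M.covNoise).trace

/-- Assembles a block matrix. -/
def ofBlocks {a b : ℕ} (F : Matrix (Fin κ) (Fin κ) (Matrix (Fin a) (Fin b) ℝ)) :
    Matrix (Fin κ × Fin a) (Fin κ × Fin b) ℝ :=
  Matrix.comp (Fin κ) (Fin κ) (Fin a) (Fin b) ℝ F

/-- The block `(k, l)` of a block matrix. -/
def block {a b : ℕ} (V : Matrix (Fin κ × Fin a) (Fin κ × Fin b) ℝ) (k l : Fin κ) :
    Matrix (Fin a) (Fin b) ℝ :=
  (Matrix.comp (Fin κ) (Fin κ) (Fin a) (Fin b) ℝ).symm V k l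

/-- `Φ^ω`: identity blocks on the diagonal, `K_k^ω A^{k-l-1} B` at the stages `l < k`. -/
def Model.Phi (ω : Option Ω) : Matrix (Fin κ × Fin r) (Fin κ × Fin r) ℝ :=
  ofBlocks (Matrix.of fun k l =>
    if l = k then 1
    else if l < k then M.K ω k * M.A ^ ((k : ℕ) - (l : ℕ) - 1) * M.B else 0)

/-- The block diagonal matrix of the `K_k^ω`. -/
def Model.Kbar (ω : Option Ω) : Matrix (Fin κ × Fin r) (Fin κ × Fin m) ℝ :=
  ofBlocks (Matrix.diagonal (M.K ω))

/-- The block diagonal matrix of the `Δ_k^ω`. -/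
def Model.Delbar (ω : Option Ω) : Matrix (Fin κ × Fin r) (Fin κ × Fin r) ℝ :=
  ofBlocks (Matrix.diagonal (M.Del ω))

/-- `Z`: the blocks `A^{k-l} B` at the stages `l ≤ k`. -/
def Model.Z : Matrix (Fin κ × Fin m) (Fin κ × Fin r) ℝ :=
  ofBlocks (Matrix.of fun k l => if l ≤ k then M.A ^ ((k : ℕ) - (l : ℕ)) * M.B else 0)

/-- `I_κ ⊗ A`. -/
def Model.Abar : Matrix (Fin κ × Fin m) (Fin κ × Fin m) ℝ :=
  (1 : Matrix (Fin κ) (Fin κ) ℝ) ⊗ₖ M.A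

/-- `I_κ ⊗ Q`, with the weight `Q` of the system. -/
def Model.Qbar : Matrix (Fin κ × Fin m) (Fin κ × Fin m) ℝ :=
  (1 : Matrix (Fin κ) (Fin κ) ℝ) ⊗ₖ M.Q none

/-- `T^ω = Z (Φ^ω)⁻¹ K^ω`. -/
def Model.T (ω : Option Ω) : Matrix (Fin κ × Fin m) (Fin κ × Fin m) ℝ :=
  M.Z * (M.Phi ω)⁻¹ * M.Kbar ω

/-- `V^ω`. -/
def Model.V (ω : Option Ω) : Matrix (Fin κ × Fin m) (Fin κ × Fin m) ℝ :=
  match ω with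
  | none => -((M.Kbar none)ᵀ * M.Delbar none * M.Kbar none)
  | some ω =>
      (M.T (some ω))ᵀ * M.Qbar * M.T (some ω) - (M.T (some ω))ᵀ * M.Qbar * M.Abar
        - M.Abarᵀ * M.Qbar * M.T (some ω)

/-- `Ξ_k^ω = V_{k,k}^ω + ∑_{l > k} (V_{k,l}^ω A^{l-k} + (A^{l-k})' V_{l,k}^ω)`. -/
def Model.Xi (ω : Option Ω) (k : Fin κ) : Matrix (Fin m) (Fin m) ℝ :=
  block (M.V ω) k k + ∑ l ∈ Finset.Ioi k,
    (block (M.V ω) k l * M.A ^ ((l : ℕ) - (k : ℕ))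
      + (M.A ^ ((l : ℕ) - (k : ℕ)))ᵀ * block (M.V ω) l k)

variable {M} {S : Type*} [MeasurableSpace S] {P : Measure S}

/-- `Σ° = E{x° (x°)'}` for the vector `x°` of the control-free states at the stages `1, …, κ`. -/
def Noise.freeCov (N : Noise M P) : Matrix (Fin κ × Fin m) (Fin κ × Fin m) ℝ :=
  Matrix.of fun a b =>
    ∫ s, N.freeState a.1.castSucc s a.2 * N.freeState b.1.castSucc s b.2 ∂P

/-- `ξ^ω`. -/
def Noise.xi (N : Noise M P) (ω : Option Ω) : ℝ :=
  match ω with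
  | none => M.del0 none - (N.freeCov * ofBlocks (Matrix.diagonal (M.Xi none))).trace
  | some _ =>
      (N.freeCov * M.Abarᵀ * M.Qbar * M.Abar).trace + κ * (M.covNoise * M.Q none).trace

/-- The linear objective `∑_ω p_ω (ξ^ω + ∑_k Tr{H_k Ξ_k^ω})`. -/
def Noise.linearObjective [Fintype Ω] (N : Noise M P) (H : Fin κ → Matrix (Fin m) (Fin m) ℝ)
    (p : Option Ω → ℝ) : ℝ :=
  ∑ ω, p ω * (N.xi ω + ∑ k : Fin κ, (H k * M.Xi ω k).trace)

/-- The transformed control `u°_k = u_k + ∑_{j < k} K_k^ω A^{k-1-j} B u_j`. -/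
def Noise.freeControl (N : Noise M P) (ω : Option Ω) (η : Signaling κ m) (γ : Policy κ m r)
    (k : Fin κ) (s : S) : Fin r → ℝ :=
  N.control η γ k s
    + ∑ j ∈ Finset.Iio k,
        (M.K ω k * M.A ^ ((k : ℕ) - (j : ℕ) - 1) * M.B) *ᵥ N.control η γ j s

end Parameters

end RobustSensor

end

set_option linter.unusedSectionVars false

noncomputable section

namespace RobustSensor

/-! ### Square-integrable random vectors -/

section SquareIntegrable

variable {S : Type*} {mS : MeasurableSpace S} {P : Measure S} {ι ι' : Type*} [Fintype ι] [Fintype ι']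

lemma memLp_mulVec {X : S → ι → ℝ} (hX : MemLp X 2 P) (W : Matrix ι' ι ℝ) :
    MemLp (fun s => W *ᵥ X s) 2 P :=
  (LinearMap.toContinuousLinearMap W.mulVecLin).comp_memLp' hX

lemma memLp_finset_sum {α : Type*} (t : Finset α) {X : α → S → ι → ℝ}
    (hX : ∀ a ∈ t, MemLp (X a) 2 P) : MemLp (fun s => ∑ a ∈ t, X a s) 2 P :=
  memLp_finsetSum t hX

lemma integrable_dotProduct {X Y : S → ι → ℝ} (hX : MemLp X 2 P) (hY : MemLp Y 2 P) :
    Integrable (fun s => X s ⬝ᵥ Y s) P :=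
  integrable_finsetSum _ fun i _ => (hX.eval i).integrable_mul (hY.eval i)

lemma integral_dotProduct {X Y : S → ι → ℝ} (hX : MemLp X 2 P) (hY : MemLp Y 2 P) :
    ∫ s, X s ⬝ᵥ Y s ∂P = ∑ i, ∫ s, X s i * Y s i ∂P :=
  integral_finsetSum _ fun i _ => (hX.eval i).integrable_mul (hY.eval i)

lemma condExp_eval_ae [IsFiniteMeasure P] (m : MeasurableSpace S) {X : S → ι → ℝ}
    (hX : Integrable X P) (i : ι) :
    (fun s => P[X | m] s i) =ᵐ[P] P[fun s => X s i | m] := by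
  have := (ContinuousLinearMap.proj (R := ℝ) (φ := fun _ : ι => ℝ) i).comp_condExp_comm
    (m := m) hX
  exact this

lemma memLp_condExp_pi [IsFiniteMeasure P] (m : MeasurableSpace S) {X : S → ι → ℝ}
    (hX : MemLp X 2 P) : MemLp (P[X | m]) 2 P := by
  refine MemLp.of_eval fun i => ?_
  refine (memLp_congr_ae (condExp_eval_ae m (hX.integrable (by norm_num)) i)).2 ?_
  exact (hX.eval i).condExp (by norm_num)

lemma integral_dotProduct_condExp [IsFiniteMeasure P] {m : MeasurableSpace S} (hm : m ≤ mS)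
    {X Y : S → ι → ℝ} (hX : MemLp X 2 P) (hY : MemLp Y 2 P) (hYm : Measurable[m] Y) :
    ∫ s, Y s ⬝ᵥ X s ∂P = ∫ s, Y s ⬝ᵥ P[X | m] s ∂P := by
  have hX' := memLp_condExp_pi m hX
  rw [integral_dotProduct hY hX, integral_dotProduct hY hX']
  refine Finset.sum_congr rfl fun i _ => ?_
  have hint : Integrable (fun s => Y s i * X s i) P := (hY.eval i).integrable_mul (hX.eval i)
  have hYi : StronglyMeasurable[m] fun s => Y s i :=
    Measurable.stronglyMeasurable ((measurable_pi_apply i).comp hYm)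
  rw [← integral_condExp hm]
  refine integral_congr_ae ?_
  refine (condExp_mul_of_stronglyMeasurable_left hYi hint
    ((hX.eval i).integrable (by norm_num))).trans ?_
  filter_upwards [condExp_eval_ae m (hX.integrable (by norm_num)) i] with s hs
  simp only [Pi.mul_apply, hs]

lemma integral_dotProduct_of_indepFun {X Y : S → ι → ℝ} (hX : MemLp X 2 P) (hY : MemLp Y 2 P)
    (h : IndepFun Y X P) (h0 : ∀ i, ∫ s, X s i ∂P = 0) : ∫ s, Y s ⬝ᵥ X s ∂P = 0 := by
  rw [integral_dotProduct hY hX]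
  refine Finset.sum_eq_zero fun i _ => ?_
  have hi : IndepFun (fun s => Y s i) (fun s => X s i) P :=
    h.comp (measurable_pi_apply i) (measurable_pi_apply i)
  rw [hi.integral_fun_mul_eq_mul_integral (hY.eval i).1 (hX.eval i).1, h0 i, mul_zero]

lemma integral_dotProduct_mulVec_eq_trace {X : S → ι → ℝ} (hX : MemLp X 2 P)
    {C : Matrix ι ι ℝ} (hC : ∀ i j, C i j = ∫ s, X s i * X s j ∂P) (W : Matrix ι ι ℝ) :
    ∫ s, X s ⬝ᵥ (W *ᵥ X s) ∂P = (C * W).trace := by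
  have hint : ∀ i j, Integrable (fun s => X s i * (W i j * X s j)) P := fun i j =>
    (hX.eval i).integrable_mul ((hX.eval j).const_mul _)
  simp only [dotProduct, Matrix.mulVec, Finset.mul_sum]
  rw [integral_finsetSum _ fun i _ => integrable_finsetSum _ fun j _ => hint i j]
  simp_rw [Matrix.trace, Matrix.diag, Matrix.mul_apply]
  rw [Finset.sum_comm]
  refine Finset.sum_congr rfl fun i _ => ?_
  rw [integral_finsetSum _ fun j _ => hint i j]
  refine Finset.sum_congr rfl fun j _ => ?_
  rw [hC j i, ← integral_mul_const]
  exact integral_congr_ae (.of_forall fun s => by simp only; ring)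

open scoped MatrixOrder Matrix.Norms.L2Operator in
/-- A random vector with a finite positive definite second moment is square integrable. -/
lemma memLp_of_lintegral_quad_lt_top {n : ℕ} {R : Matrix (Fin n) (Fin n) ℝ} (hR : R.PosDef)
    {X : S → Fin n → ℝ} (hX : Measurable X)
    (h : ∫⁻ s, ENNReal.ofReal (quad R (X s)) ∂P < ∞) : MemLp X 2 P := by
  obtain ⟨U, rfl⟩ := CStarAlgebra.nonneg_iff_eq_star_mul_self.mp hR.posSemidef.nonneg
  have hdet : IsUnit U.det := by
    have := hR.det_pos.ne'
    rw [Matrix.det_mul] at this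
    exact (right_ne_zero_of_mul this).isUnit
  have hquad : ∀ x : Fin n → ℝ, quad (star U * U) x = ∑ i, (U *ᵥ x) i ^ 2 := fun x => by
    simp only [quad, Matrix.star_eq_conjTranspose, Matrix.conjTranspose_eq_transpose_of_trivial]
    rw [← Matrix.mulVec_mulVec, Matrix.dotProduct_mulVec, Matrix.vecMul_transpose]
    simp only [dotProduct, sq]
  have hUX : MemLp (fun s => U *ᵥ X s) 2 P := by
    refine MemLp.of_eval fun i => ?_
    have hmeas : Measurable fun s => (U *ᵥ X s) i := by
      simp only [Matrix.mulVec, dotProduct]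
      fun_prop
    refine (memLp_two_iff_integrable_sq hmeas.aestronglyMeasurable).2
      ⟨(hmeas.pow_const 2).aestronglyMeasurable, ?_⟩
    rw [hasFiniteIntegral_iff_ofReal (.of_forall fun s => sq_nonneg _)]
    refine lt_of_le_of_lt (lintegral_mono fun s => ENNReal.ofReal_le_ofReal ?_) h
    rw [hquad]
    exact Finset.single_le_sum (f := fun i => (U *ᵥ X s) i ^ 2) (fun i _ => sq_nonneg _)
      (Finset.mem_univ i)
  have := memLp_mulVec hUX U⁻¹
  simpa only [Matrix.mulVec_mulVec, Matrix.nonsing_inv_mul U hdet, Matrix.one_mulVec] using this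

end SquareIntegrable

/-! ### Quadratic forms and the Riccati recursion -/

section QuadraticForms

lemma dotProduct_transpose_mulVec {ι ι' : Type*} [Fintype ι] [Fintype ι'] (W : Matrix ι ι' ℝ)
    (x : ι' → ℝ) (y : ι → ℝ) : x ⬝ᵥ (Wᵀ *ᵥ y) = (W *ᵥ x) ⬝ᵥ y := by
  rw [Matrix.dotProduct_mulVec, Matrix.vecMul_transpose]

lemma dotProduct_mulVec_comm_of_isSymm {ι : Type*} [Fintype ι] {W : Matrix ι ι ℝ} (hW : W.IsSymm)
    (x y : ι → ℝ) : x ⬝ᵥ (W *ᵥ y) = y ⬝ᵥ (W *ᵥ x) := by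
  conv_lhs => rw [← hW.eq]
  rw [dotProduct_transpose_mulVec, dotProduct_comm]

lemma quad_add {n : ℕ} {W : Matrix (Fin n) (Fin n) ℝ} (hW : W.IsSymm) (x y : Fin n → ℝ) :
    quad W (x + y) = quad W x + 2 * (x ⬝ᵥ (W *ᵥ y)) + quad W y := by
  simp only [quad, Matrix.mulVec_add, add_dotProduct, dotProduct_add]
  rw [dotProduct_mulVec_comm_of_isSymm hW y x]
  ring

lemma quad_sub_left {n : ℕ} (V W : Matrix (Fin n) (Fin n) ℝ) (x : Fin n → ℝ) :
    quad (V - W) x = quad V x - quad W x := by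
  simp [quad, Matrix.sub_mulVec]

lemma quad_mulVec {n l : ℕ} (W : Matrix (Fin n) (Fin n) ℝ) (M : Matrix (Fin n) (Fin l) ℝ)
    (x : Fin l → ℝ) : quad W (M *ᵥ x) = quad (Mᵀ * W * M) x := by
  simp only [quad, ← Matrix.mulVec_mulVec, dotProduct_transpose_mulVec]

lemma isSymm_of_posSemidef {n : ℕ} {W : Matrix (Fin n) (Fin n) ℝ} (hW : W.PosSemidef) :
    W.IsSymm := by
  have := hW.isHermitian.eq
  rwa [Matrix.conjTranspose_eq_transpose_of_trivial] at this

lemma quad_nonneg {n : ℕ} {W : Matrix (Fin n) (Fin n) ℝ} (hW : W.PosSemidef) (x : Fin n → ℝ) :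
    0 ≤ quad W x := by
  have h := hW.dotProduct_mulVec_nonneg x
  rwa [star_trivial] at h

lemma quad_eq_zero_iff {n : ℕ} {W : Matrix (Fin n) (Fin n) ℝ} (hW : W.PosDef) (x : Fin n → ℝ) :
    quad W x = 0 ↔ x = 0 := by
  refine ⟨fun h => ?_, fun h => by simp [quad, h]⟩
  by_contra hx
  have := hW.dotProduct_mulVec_pos hx
  simp only [star_trivial] at this
  exact this.ne' h

lemma posDef_conj_add {n l : ℕ} {W : Matrix (Fin n) (Fin n) ℝ} (hW : W.PosSemidef)
    (B : Matrix (Fin n) (Fin l) ℝ) {R : Matrix (Fin l) (Fin l) ℝ} (hR : R.PosDef) :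
    (Bᵀ * W * B + R).PosDef := by
  have h := hW.conjTranspose_mul_mul_same B
  rw [Matrix.conjTranspose_eq_transpose_of_trivial] at h
  exact Matrix.PosDef.posSemidef_add h hR

/-- Completion of the square in one step of the linear-quadratic recursion. -/
lemma quad_complete_square {n l : ℕ} {W : Matrix (Fin n) (Fin n) ℝ} (hW : W.IsSymm)
    (A : Matrix (Fin n) (Fin n) ℝ) (B : Matrix (Fin n) (Fin l) ℝ) {R : Matrix (Fin l) (Fin l) ℝ}
    (hD : (Bᵀ * W * B + R).PosDef) (x : Fin n → ℝ) (u : Fin l → ℝ) :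
    quad W (A *ᵥ x + B *ᵥ u) + quad R u =
      quad (Aᵀ * (W - W * B * (Bᵀ * W * B + R)⁻¹ * Bᵀ * W) * A) x
        + quad (Bᵀ * W * B + R) (u + ((Bᵀ * W * B + R)⁻¹ * Bᵀ * W * A) *ᵥ x) := by
  set D := Bᵀ * W * B + R with hDdef
  have hDs : D.IsSymm := isSymm_of_posSemidef hD.posSemidef
  have hDu : IsUnit D.det := hD.det_pos.ne'.isUnit
  have h1 : D *ᵥ ((D⁻¹ * Bᵀ * W * A) *ᵥ x) = Bᵀ *ᵥ (W *ᵥ (A *ᵥ x)) := by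
    simp only [Matrix.mulVec_mulVec, ← Matrix.mul_assoc, Matrix.mul_nonsing_inv D hDu,
      Matrix.one_mul]
  have h2 : quad (Aᵀ * (W - W * B * D⁻¹ * Bᵀ * W) * A) x
      = quad W (A *ᵥ x) - (A *ᵥ x) ⬝ᵥ ((W * B) *ᵥ ((D⁻¹ * Bᵀ * W * A) *ᵥ x)) := by
    rw [← quad_mulVec, quad_sub_left]
    simp only [quad, Matrix.mulVec_mulVec, Matrix.mul_assoc]
  have h3 : (A *ᵥ x) ⬝ᵥ ((W * B) *ᵥ ((D⁻¹ * Bᵀ * W * A) *ᵥ x))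
      = quad D ((D⁻¹ * Bᵀ * W * A) *ᵥ x) := by
    rw [quad, h1, dotProduct_transpose_mulVec, dotProduct_mulVec_comm_of_isSymm hW,
      ← Matrix.mulVec_mulVec _ W B]
  have h4 : quad D u = quad W (B *ᵥ u) + quad R u := by
    rw [quad_mulVec]
    simp only [hDdef, quad, Matrix.add_mulVec, dotProduct_add]
  rw [quad_add hW, quad_add hDs, h2, h3, h4, h1, dotProduct_transpose_mulVec,
    dotProduct_mulVec_comm_of_isSymm hW (A *ᵥ x)]
  ring

variable {κ m r : ℕ} {Ω : Type*} (M : Model κ m r Ω)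

lemma Model.riccati_posSemidef (ω : Option Ω) (n : ℕ) : (M.riccati ω n).PosSemidef := by
  induction n with
  | zero => exact M.Q_posSemidef ω
  | succ n ih =>
    have hD := posDef_conj_add ih M.B (M.R_posDef ω)
    refine (M.Q_posSemidef ω).add ?_
    have hs := isSymm_of_posSemidef ih
    have hDs := isSymm_of_posSemidef hD.posSemidef
    refine Matrix.PosSemidef.of_dotProduct_mulVec_nonneg ?_ fun x => ?_
    · rw [Matrix.IsHermitian, Matrix.conjTranspose_eq_transpose_of_trivial]
      simp only [Matrix.transpose_mul, Matrix.transpose_sub, Matrix.transpose_transpose,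
        Matrix.transpose_nonsing_inv, hs.eq, hDs.eq]
      simp only [Matrix.mul_assoc]
    · rw [star_trivial]
      have h := quad_complete_square hs M.A M.B hD x
        (-(((M.Bᵀ * M.riccati ω n * M.B + M.R ω)⁻¹ * M.Bᵀ * M.riccati ω n * M.A) *ᵥ x))
      have h0 : quad (M.Bᵀ * M.riccati ω n * M.B + M.R ω) 0 = 0 := by simp [quad]
      rw [neg_add_cancel, h0, add_zero] at h
      change 0 ≤ quad _ x
      rw [← h]
      exact add_nonneg (quad_nonneg ih _) (quad_nonneg (M.R_posDef ω).posSemidef _)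

lemma Model.Qt_posSemidef (ω : Option Ω) (t : ℕ) : (M.Qt ω t).PosSemidef :=
  M.riccati_posSemidef ω _

lemma Model.Del_posDef (ω : Option Ω) (k : Fin κ) : (M.Del ω k).PosDef :=
  posDef_conj_add (M.Qt_posSemidef ω _) M.B (M.R_posDef ω)

lemma Model.Qt_last (ω : Option Ω) : M.Qt ω κ = M.Q ω := by
  simp [Model.Qt, Model.riccati]

lemma Model.quad_Qt_step (ω : Option Ω) (k : Fin κ) (x : Fin m → ℝ) (u : Fin r → ℝ) :
    quad (M.Qt ω (k + 1)) (M.A *ᵥ x + M.B *ᵥ u) + quad (M.R ω) u =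
      quad (M.Qt ω k - M.Q ω) x + quad (M.Del ω k) (u + M.K ω k *ᵥ x) := by
  have h : M.Qt ω k - M.Q ω = M.Aᵀ * (M.Qt ω (k + 1) - M.Qt ω (k + 1) * M.B
      * (M.Bᵀ * M.Qt ω (k + 1) * M.B + M.R ω)⁻¹ * M.Bᵀ * M.Qt ω (k + 1)) * M.A := by
    have hk : κ - (k : ℕ) = κ - (k + 1) + 1 := by omega
    simp only [Model.Qt, hk, Model.riccati, add_sub_cancel_left]
  rw [h]
  exact quad_complete_square (isSymm_of_posSemidef (M.Qt_posSemidef ω _)) M.A M.B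
    (M.Del_posDef ω k) x u

end QuadraticForms

/-! ### Block matrices -/

section Blocks

variable {κ : ℕ}

lemma ofBlocks_apply {a b : ℕ} (F : Matrix (Fin κ) (Fin κ) (Matrix (Fin a) (Fin b) ℝ))
    (p : Fin κ × Fin a) (q : Fin κ × Fin b) : ofBlocks F p q = F p.1 q.1 p.2 q.2 := rfl

lemma ofBlocks_block {a b : ℕ} (V : Matrix (Fin κ × Fin a) (Fin κ × Fin b) ℝ) :
    ofBlocks (Matrix.of fun k l => block V k l) = V := rfl

lemma ofBlocks_mulVec {a b : ℕ} (F : Matrix (Fin κ) (Fin κ) (Matrix (Fin a) (Fin b) ℝ))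
    (X : Fin κ → Fin b → ℝ) :
    ofBlocks F *ᵥ Function.uncurry X = Function.uncurry fun k => ∑ l, F k l *ᵥ X l := by
  ext ⟨k, i⟩
  simp [Matrix.mulVec, dotProduct, Fintype.sum_prod_type, ofBlocks_apply, Finset.sum_apply]

lemma ofBlocks_diagonal_mulVec {a b : ℕ} (D : Fin κ → Matrix (Fin a) (Fin b) ℝ)
    (X : Fin κ → Fin b → ℝ) :
    ofBlocks (Matrix.diagonal D) *ᵥ Function.uncurry X
      = Function.uncurry fun k => D k *ᵥ X k := by
  rw [ofBlocks_mulVec]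
  congr 1
  ext1 k
  rw [Finset.sum_eq_single k (fun l _ hl => by simp [Matrix.diagonal_apply_ne' _ hl]) (by simp),
    Matrix.diagonal_apply_eq]

lemma uncurry_dotProduct {a : ℕ} (X Y : Fin κ → Fin a → ℝ) :
    Function.uncurry X ⬝ᵥ Function.uncurry Y = ∑ k, X k ⬝ᵥ Y k := by
  simp [dotProduct, Fintype.sum_prod_type]

lemma one_kronecker_eq_ofBlocks {a : ℕ} (W : Matrix (Fin a) (Fin a) ℝ) :
    (1 : Matrix (Fin κ) (Fin κ) ℝ) ⊗ₖ W = ofBlocks (Matrix.diagonal fun _ => W) := by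
  ext ⟨k, i⟩ ⟨l, j⟩
  rw [ofBlocks_apply, Matrix.kroneckerMap_apply]
  by_cases h : k = l
  · subst h; simp
  · simp [h]

lemma one_kronecker_mulVec {a : ℕ} (W : Matrix (Fin a) (Fin a) ℝ) (X : Fin κ → Fin a → ℝ) :
    ((1 : Matrix (Fin κ) (Fin κ) ℝ) ⊗ₖ W) *ᵥ Function.uncurry X
      = Function.uncurry fun k => W *ᵥ X k := by
  rw [one_kronecker_eq_ofBlocks, ofBlocks_diagonal_mulVec]

lemma uncurry_dotProduct_mulVec {a b : ℕ} (V : Matrix (Fin κ × Fin a) (Fin κ × Fin b) ℝ)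
    (X : Fin κ → Fin a → ℝ) (Y : Fin κ → Fin b → ℝ) :
    Function.uncurry X ⬝ᵥ (V *ᵥ Function.uncurry Y) = ∑ k, ∑ l, X k ⬝ᵥ (block V k l *ᵥ Y l) := by
  conv_lhs => rw [← ofBlocks_block V]
  rw [ofBlocks_mulVec, uncurry_dotProduct]
  simp [dotProduct_sum]

/-- Splits a double sum into its diagonal and pairs of off-diagonal terms. -/
lemma sum_sum_eq_diag_add_sum_Ioi (f : Fin κ → Fin κ → ℝ) :
    ∑ k, ∑ l, f k l = ∑ k, (f k k + ∑ l ∈ Finset.Ioi k, (f k l + f l k)) := by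
  have h1 : ∀ k, ∑ l, f k l
      = f k k + ∑ l ∈ Finset.Ioi k, f k l + ∑ l ∈ Finset.Iio k, f k l := fun k => by
    have hs : (Finset.univ : Finset (Fin κ))
        = insert k (Finset.Ioi k) ∪ Finset.Iio k := by
      ext l
      simp only [Finset.mem_univ, Finset.mem_union, Finset.mem_insert, Finset.mem_Ioi,
        Finset.mem_Iio, true_iff]
      rcases lt_trichotomy l k with h | h | h <;> tauto
    rw [hs, Finset.sum_union, Finset.sum_insert (by simp)]
    rw [Finset.disjoint_left]
    intro l
    simp only [Finset.mem_insert, Finset.mem_Ioi, Finset.mem_Iio]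
    rintro (rfl | h)
    · exact lt_irrefl _
    · exact h.not_gt
  have h2 : ∑ k, ∑ l ∈ Finset.Iio k, f k l = ∑ k, ∑ l ∈ Finset.Ioi k, f l k :=
    Finset.sum_comm' (by simp)
  simp only [h1, Finset.sum_add_distrib, h2]
  ring

variable {m r : ℕ} {Ω : Type*} (M : Model κ m r Ω)

lemma Model.Phi_mulVec (ω : Option Ω) (U : Fin κ → Fin r → ℝ) :
    M.Phi ω *ᵥ Function.uncurry U = Function.uncurry fun k : Fin κ => U k + ∑ j ∈ Finset.Iio k,
      (M.K ω k * M.A ^ ((k : ℕ) - (j : ℕ) - 1) * M.B) *ᵥ U j := by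
  rw [Model.Phi, ofBlocks_mulVec]
  congr 1
  ext1 k
  rw [← Finset.add_sum_erase _ _ (Finset.mem_univ k)]
  congr 1
  · simp
  · rw [← Finset.sum_subset (s₁ := Finset.Iio k)]
    · refine Finset.sum_congr rfl fun l hl => ?_
      rw [Finset.mem_Iio] at hl
      simp [hl, hl.ne]
    · intro l hl
      simpa using (Finset.mem_Iio.1 hl).ne
    · intro l hl hl'
      simp only [Finset.mem_erase, Finset.mem_univ, and_true, Finset.mem_Iio] at hl hl'
      simp [hl, hl']

lemma Model.Z_mulVec (U : Fin κ → Fin r → ℝ) :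
    M.Z *ᵥ Function.uncurry U = Function.uncurry fun k : Fin κ =>
      ∑ j ∈ Finset.Iic k, (M.A ^ ((k : ℕ) - (j : ℕ)) * M.B) *ᵥ U j := by
  rw [Model.Z, ofBlocks_mulVec]
  congr 1
  ext1 k
  rw [← Finset.sum_subset (Finset.subset_univ (Finset.Iic k))]
  · refine Finset.sum_congr rfl fun l hl => ?_
    simp [Finset.mem_Iic.1 hl]
  · intro l _ hl
    rw [Finset.mem_Iic] at hl
    simp [hl]

lemma Model.isUnit_det_Phi (ω : Option Ω) : IsUnit (M.Phi ω).det := by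
  rw [isUnit_iff_ne_zero, ne_eq, ← Matrix.exists_mulVec_eq_zero_iff]
  rintro ⟨v, hv, h⟩
  refine hv ?_
  obtain ⟨U, rfl⟩ : ∃ U : Fin κ → Fin r → ℝ, v = Function.uncurry U :=
    ⟨Function.curry v, (Function.uncurry_curry v).symm⟩
  rw [M.Phi_mulVec] at h
  have hU : ∀ k, U k = 0 := fun k => by
    induction k using WellFoundedLT.induction with
    | ind k ih =>
      have hk : U k + ∑ j ∈ Finset.Iio k,
          (M.K ω k * M.A ^ ((k : ℕ) - (j : ℕ) - 1) * M.B) *ᵥ U j = 0 := by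
        ext i
        exact congrFun h (k, i)
      rwa [Finset.sum_eq_zero, add_zero] at hk
      intro j hj
      rw [ih j (Finset.mem_Iio.1 hj), Matrix.mulVec_zero]
  ext ⟨k, i⟩
  exact congrFun (hU k) i

lemma block_transpose {a b : ℕ} (V : Matrix (Fin κ × Fin a) (Fin κ × Fin b) ℝ) (k l : Fin κ) :
    (block V k l)ᵀ = block Vᵀ l k := rfl

lemma Model.Qbar_isSymm : M.Qbar.IsSymm := by
  rw [Matrix.IsSymm, Model.Qbar, ← Matrix.kroneckerMap_transpose, Matrix.transpose_one,
    (isSymm_of_posSemidef (M.Q_posSemidef none)).eq]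

lemma Model.V_isSymm (ω : Option Ω) : (M.V ω).IsSymm := by
  cases ω with
  | none =>
    have h : (M.Delbar none)ᵀ = M.Delbar none := by
      ext ⟨k, i⟩ ⟨l, j⟩
      rw [Matrix.transpose_apply, Model.Delbar, ofBlocks_apply, ofBlocks_apply]
      by_cases hkl : k = l
      · subst hkl
        simp only [Matrix.diagonal_apply_eq]
        exact congrFun₂ (isSymm_of_posSemidef (M.Del_posDef none k).posSemidef).eq i j
      · simp [Matrix.diagonal_apply_ne _ hkl, Matrix.diagonal_apply_ne' _ hkl]
    simp only [Matrix.IsSymm, Model.V, Matrix.transpose_neg, Matrix.transpose_mul,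
      Matrix.transpose_transpose, h, Matrix.mul_assoc]
  | some ω =>
    simp only [Matrix.IsSymm, Model.V, Matrix.transpose_sub, Matrix.transpose_mul,
      Matrix.transpose_transpose, M.Qbar_isSymm.eq, Matrix.mul_assoc]
    abel

lemma Model.Xi_isSymm (ω : Option Ω) (k : Fin κ) : (M.Xi ω k).IsSymm := by
  have hV : ∀ k l, (block (M.V ω) k l)ᵀ = block (M.V ω) l k := fun k l => by
    rw [block_transpose, (M.V_isSymm ω).eq]
  simp only [Matrix.IsSymm, Model.Xi, Matrix.transpose_add, Matrix.transpose_sum,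
    Matrix.transpose_mul, Matrix.transpose_transpose, hV]
  congr 1
  exact Finset.sum_congr rfl fun l _ => add_comm _ _

end Blocks

/-! ### Trajectories -/

section Measurability

variable {S : Type*} {m' : MeasurableSpace S} {a b : ℕ}

lemma measurable_mulVec_comp {X : S → Fin a → ℝ} (hX : Measurable X)
    (W : Matrix (Fin b) (Fin a) ℝ) : Measurable fun s => W *ᵥ X s :=
  (LinearMap.toContinuousLinearMap W.mulVecLin).continuous.measurable.comp hX

lemma measurable_add_vec {X Y : S → Fin a → ℝ} (hX : Measurable X) (hY : Measurable Y) :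
    Measurable fun s => X s + Y s :=
  hX.add hY

lemma measurable_sub_vec {X Y : S → Fin a → ℝ} (hX : Measurable X) (hY : Measurable Y) :
    Measurable fun s => X s - Y s :=
  hX.sub hY

lemma measurable_of_forall_apply {ι β : Type*} [MeasurableSpace β] {X : S → ι → β}
    (hX : ∀ i, Measurable fun s => X s i) : Measurable X :=
  measurable_pi_lambda _ hX

end Measurability

section TrajectoryLemmas

variable {κ m r : ℕ} {Ω : Type*} {M : Model κ m r Ω} {S : Type*} {mS : MeasurableSpace S}
  {P : Measure S} (N : Noise M P)

lemma Noise.state_zero (η : Signaling κ m) (γ : Policy κ m r) (s : S) :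
    N.state η γ 0 s = N.x₁ s := by
  rw [Noise.state.eq_def]
  rfl

lemma Noise.state_succ (η : Signaling κ m) (γ : Policy κ m r) (k : Fin κ) (s : S) :
    N.state η γ k.succ s
      = M.A *ᵥ N.state η γ k.castSucc s + M.B *ᵥ N.control η γ k s + N.w k s := by
  rw [Noise.state.eq_def]
  rfl

lemma Noise.freeState_zero (s : S) : N.freeState 0 s = N.x₁ s := by
  rw [Noise.freeState.eq_def]
  rfl

lemma Noise.freeState_succ (k : Fin κ) (s : S) :
    N.freeState k.succ s = M.A *ᵥ N.freeState k.castSucc s + N.w k s := by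
  rw [Noise.freeState.eq_def]
  rfl

lemma Noise.state_eq_freeState_add (η : Signaling κ m) (γ : Policy κ m r) (t : Fin (κ + 1))
    (s : S) :
    N.state η γ t s = N.freeState t s
      + ∑ j : Fin κ with j.val < t.val,
          (M.A ^ ((t : ℕ) - (j : ℕ) - 1) * M.B) *ᵥ N.control η γ j s := by
  induction t using Fin.induction with
  | zero => simp [N.state_zero, N.freeState_zero]
  | succ k ih =>
    have hs : (Finset.univ.filter fun j : Fin κ => j.val < k.succ.val)
        = insert k (Finset.univ.filter fun j : Fin κ => j.val < k.castSucc.val) := by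
      ext j
      simp [Fin.ext_iff]
      omega
    rw [N.state_succ, ih, N.freeState_succ, hs, Finset.sum_insert (by simp), Matrix.mulVec_add,
      Matrix.mulVec_sum]
    have he : (k.succ : ℕ) - (k : ℕ) - 1 = 0 := by simp
    rw [he, pow_zero, Matrix.one_mul]
    have : ∀ j ∈ Finset.univ.filter fun j : Fin κ => j.val < k.castSucc.val,
        M.A *ᵥ ((M.A ^ ((k.castSucc : ℕ) - (j : ℕ) - 1) * M.B) *ᵥ N.control η γ j s)
          = (M.A ^ ((k.succ : ℕ) - (j : ℕ) - 1) * M.B) *ᵥ N.control η γ j s := fun j hj => by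
      have hj' : j.val < k.val := by simpa using hj
      have : (k.succ : ℕ) - (j : ℕ) - 1 = ((k.castSucc : ℕ) - (j : ℕ) - 1) + 1 := by
        simp only [Fin.val_succ, Fin.val_castSucc]; omega
      rw [this, Matrix.mulVec_mulVec, pow_succ', Matrix.mul_assoc]
    rw [Finset.sum_congr rfl this]
    abel

lemma Noise.state_castSucc_eq (η : Signaling κ m) (γ : Policy κ m r) (k : Fin κ) (s : S) :
    N.state η γ k.castSucc s = N.freeState k.castSucc s
      + ∑ j ∈ Finset.Iio k, (M.A ^ ((k : ℕ) - (j : ℕ) - 1) * M.B) *ᵥ N.control η γ j s := by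
  rw [N.state_eq_freeState_add]
  congr 1
  exact Finset.sum_congr (by ext j; simp) fun _ _ => rfl

lemma Noise.state_succ_eq (η : Signaling κ m) (γ : Policy κ m r) (k : Fin κ) (s : S) :
    N.state η γ k.succ s = N.freeState k.succ s
      + ∑ j ∈ Finset.Iic k, (M.A ^ ((k : ℕ) - (j : ℕ)) * M.B) *ᵥ N.control η γ j s := by
  rw [N.state_eq_freeState_add]
  congr 1
  refine Finset.sum_congr (by ext j; simp) fun j _ => ?_
  have : (k.succ : ℕ) - (j : ℕ) - 1 = (k : ℕ) - j := by simp only [Fin.val_succ]; omega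
  rw [this]

/-- The contribution of the controls to the signal at stage `k`. -/
def Model.signalShift (M : Model κ m r Ω) (η : Signaling κ m) (k : Fin κ) (u : Fin κ → Fin r → ℝ) :
    Fin m → ℝ :=
  ∑ i : Finset.Iic k, (η.gain k i)ᵀ *ᵥ
    ∑ j ∈ Finset.Iio i.1, (M.A ^ ((i.1 : ℕ) - (j : ℕ) - 1) * M.B) *ᵥ u j

lemma Model.signalShift_congr (η : Signaling κ m) (k : Fin κ) {u u' : Fin κ → Fin r → ℝ}
    (h : ∀ j < k, u j = u' j) : M.signalShift η k u = M.signalShift η k u' := by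
  refine Finset.sum_congr rfl fun i _ => ?_
  congr 1
  refine Finset.sum_congr rfl fun j hj => ?_
  rw [h j ((Finset.mem_Iio.1 hj).trans_le (Finset.mem_Iic.1 i.2))]

/-- The control-free signal at a stage. -/
def Noise.freeSignal (η : Signaling κ m) (k : Fin κ) (s : S) : Fin m → ℝ :=
  ∑ i : Finset.Iic k, (η.gain k i)ᵀ *ᵥ N.freeState i.1.castSucc s + N.v η k s

lemma Noise.freeSignals_apply (η : Signaling κ m) (k : Fin κ) (s : S) (j : Finset.Iic k) :
    N.freeSignals η k s j = N.freeSignal η j.1 s := rfl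

lemma Noise.signals_apply (η : Signaling κ m) (γ : Policy κ m r) (k : Fin κ) (s : S)
    (j : Finset.Iic k) : N.signals η γ k s j = N.signal η γ j.1 s := rfl

lemma Noise.signal_eq (η : Signaling κ m) (γ : Policy κ m r) (k : Fin κ) (s : S) :
    N.signal η γ k s
      = N.freeSignal η k s + M.signalShift η k fun j => N.control η γ j s := by
  simp only [Noise.signal, Noise.freeSignal, Model.signalShift, N.state_castSucc_eq,
    Matrix.mulVec_add, Finset.sum_add_distrib]
  abel

/-! ### Information generated by the signals -/

lemma Model.measurable_signalShift {m' : MeasurableSpace S} (η : Signaling κ m) (k : Fin κ)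
    {u : Fin κ → S → Fin r → ℝ} (hu : ∀ j < k, Measurable (u j)) :
    Measurable fun s => M.signalShift η k fun j => u j s := by
  refine Finset.measurable_sum _ fun i _ => measurable_mulVec_comp ?_ _
  refine Finset.measurable_sum _ fun j hj => measurable_mulVec_comp (hu j ?_) _
  exact (Finset.mem_Iio.1 hj).trans_le (Finset.mem_Iic.1 i.2)

/-- The information available at stage `k`. -/
abbrev Noise.info (η : Signaling κ m) (k : Fin κ) : MeasurableSpace S :=
  MeasurableSpace.comap (N.freeSignals η k) inferInstance

lemma Noise.measurable_freeSignal_info (η : Signaling κ m) {j k : Fin κ} (h : j ≤ k) :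
    Measurable[N.info η k] (N.freeSignal η j) :=
  (measurable_pi_apply (⟨j, Finset.mem_Iic.2 h⟩ : Finset.Iic k)).comp
    (comap_measurable (N.freeSignals η k))

lemma Noise.info_mono (η : Signaling κ m) {j k : Fin κ} (h : j ≤ k) :
    N.info η j ≤ N.info η k := by
  refine Measurable.comap_le ?_
  refine measurable_of_forall_apply fun i => ?_
  exact N.measurable_freeSignal_info η ((Finset.mem_Iic.1 i.2).trans h)

lemma Noise.measurable_signals_info (η : Signaling κ m) (γ : Policy κ m r) (k : Fin κ) :
    Measurable[N.info η k] (N.signals η γ k) := by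
  induction k using WellFoundedLT.induction with
  | ind k ih =>
    refine measurable_of_forall_apply fun i => ?_
    have hi := Finset.mem_Iic.1 i.2
    simp only [N.signals_apply, N.signal_eq]
    refine measurable_add_vec (N.measurable_freeSignal_info η hi) ?_
    refine Model.measurable_signalShift η i.1 fun j hj => ?_
    have hjk := hj.trans_le hi
    exact ((γ.measurable_act j).comp (ih j hjk)).mono (N.info_mono η hjk.le) le_rfl

lemma Noise.measurable_control_info (η : Signaling κ m) (γ : Policy κ m r) {j k : Fin κ}
    (h : j ≤ k) : Measurable[N.info η k] (N.control η γ j) :=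
  ((γ.measurable_act j).comp (N.measurable_signals_info η γ j)).mono (N.info_mono η h) le_rfl

lemma Noise.comap_signals_eq_info (η : Signaling κ m) (γ : Policy κ m r) (k : Fin κ) :
    MeasurableSpace.comap (N.signals η γ k) inferInstance = N.info η k := by
  refine le_antisymm (N.measurable_signals_info η γ k).comap_le ?_
  have hsig : ∀ j ≤ k, Measurable[MeasurableSpace.comap (N.signals η γ k) inferInstance]
      (N.signal η γ j) := fun j hj =>
    (measurable_pi_apply (⟨j, Finset.mem_Iic.2 hj⟩ : Finset.Iic k)).comp
      (comap_measurable (N.signals η γ k))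
  have hctrl : ∀ j ≤ k, Measurable[MeasurableSpace.comap (N.signals η γ k) inferInstance]
      (N.control η γ j) := fun j hj =>
    (γ.measurable_act j).comp (measurable_of_forall_apply fun i =>
      hsig i.1 ((Finset.mem_Iic.1 i.2).trans hj))
  refine Measurable.comap_le (measurable_of_forall_apply fun i => ?_)
  have hi := Finset.mem_Iic.1 i.2
  have heq : (fun s => N.freeSignals η k s i)
      = fun s => N.signal η γ i.1 s - M.signalShift η i.1 fun j => N.control η γ j s := by
    ext1 s
    rw [N.signal_eq, add_sub_cancel_right, N.freeSignals_apply]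
  rw [heq]
  exact measurable_sub_vec (hsig i.1 hi)
    (Model.measurable_signalShift η i.1 fun j hj => hctrl j (hj.le.trans hi))

/-- The posterior estimate of the control-free state, as a function of the signaling rule. -/
def Noise.post (η : Signaling κ m) (k : Fin κ) : S → Fin m → ℝ :=
  P[N.freeState k.castSucc | N.info η k]

lemma Noise.posterior_eq_post (η : Signaling κ m) (γ : Policy κ m r) (k : Fin κ) :
    N.posterior η γ k = N.post η k := by
  rw [Noise.posterior, N.comap_signals_eq_info, Noise.post]

lemma Noise.measurable_post_info (η : Signaling κ m) {j k : Fin κ} (h : j ≤ k) :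
    Measurable[N.info η k] (N.post η j) :=
  stronglyMeasurable_condExp.measurable.mono (N.info_mono η h) le_rfl

/-! ### Independence of the state noise from the past -/

/-- The primitive random vectors, as one family. -/
def Noise.prim (η : Signaling κ m) : Unit ⊕ (Fin κ ⊕ Fin κ) → S → Fin m → ℝ :=
  Sum.elim (fun _ : Unit => N.x₁) (Sum.elim N.w (N.v η))

/-- The indices of the primitive random vectors other than the state noise from time `k` on. -/
def pastIndex (k : Fin κ) : Set (Unit ⊕ (Fin κ ⊕ Fin κ)) :=
  {i | ∀ l, k ≤ l → i ≠ Sum.inr (Sum.inl l)}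

/-- The information carried by everything but the state noise from time `k` on. -/
abbrev Noise.past (η : Signaling κ m) (k : Fin κ) : MeasurableSpace S :=
  ⨆ i ∈ pastIndex k, MeasurableSpace.comap (N.prim η i) inferInstance

lemma Noise.measurable_prim_past (η : Signaling κ m) {k : Fin κ}
    {i : Unit ⊕ (Fin κ ⊕ Fin κ)} (hi : i ∈ pastIndex k) :
    Measurable[N.past η k] (N.prim η i) :=
  (comap_measurable (N.prim η i)).mono
    (le_iSup₂_of_le (f := fun i (_ : i ∈ pastIndex k) =>
      MeasurableSpace.comap (N.prim η i) inferInstance) i hi le_rfl) le_rfl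

lemma Noise.measurable_prim (η : Signaling κ m) (i : Unit ⊕ (Fin κ ⊕ Fin κ)) :
    Measurable (N.prim η i) := by
  rcases i with _ | i | i
  exacts [N.measurable_x₁, N.measurable_w i, N.measurable_v η i]

lemma Noise.past_le (η : Signaling κ m) (k : Fin κ) : N.past η k ≤ mS :=
  iSup₂_le fun i _ => (N.measurable_prim η i).comap_le

lemma Noise.measurable_freeState_past (η : Signaling κ m) {k : Fin κ} (t : Fin (κ + 1))
    (h : t.val ≤ k.val) : Measurable[N.past η k] (N.freeState t) := by
  induction t using Fin.induction with
  | zero =>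
    have : N.freeState 0 = N.prim η (Sum.inl ()) := funext fun s => N.freeState_zero s
    rw [this]
    exact N.measurable_prim_past η fun l _ => by simp
  | succ j ih =>
    have hj : j.val < k.val := by simpa using h
    have : N.freeState j.succ = fun s => M.A *ᵥ N.freeState j.castSucc s + N.w j s :=
      funext fun s => N.freeState_succ j s
    rw [this]
    refine measurable_add_vec
      (measurable_mulVec_comp (ih (by simpa using hj.le)) _) ?_
    refine N.measurable_prim_past η (i := Sum.inr (Sum.inl j)) fun l hl => ?_
    simp only [ne_eq, Sum.inr.injEq, Sum.inl.injEq]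
    rintro rfl
    exact absurd (Fin.le_def.1 hl) (not_le.2 hj)

lemma Noise.info_le_past (η : Signaling κ m) {j k : Fin κ} (h : j ≤ k) :
    N.info η j ≤ N.past η k := by
  refine (N.info_mono η h).trans (Measurable.comap_le ?_)
  refine measurable_of_forall_apply fun i => ?_
  refine measurable_add_vec ?_
    (N.measurable_prim_past η (i := Sum.inr (Sum.inr i.1)) fun l _ => by simp)
  refine Finset.measurable_sum _ fun l _ => measurable_mulVec_comp ?_ _
  refine N.measurable_freeState_past η _ ?_
  exact Fin.le_def.1 ((Finset.mem_Iic.1 l.2).trans (Finset.mem_Iic.1 i.2))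

lemma Noise.info_le (η : Signaling κ m) (k : Fin κ) : N.info η k ≤ mS :=
  (N.info_le_past η le_rfl).trans (N.past_le η k)

lemma Noise.measurable_control_past (η : Signaling κ m) (γ : Policy κ m r) {j k : Fin κ}
    (h : j ≤ k) : Measurable[N.past η k] (N.control η γ j) :=
  (N.measurable_control_info η γ le_rfl).mono (N.info_le_past η h) le_rfl

lemma Noise.measurable_control (η : Signaling κ m) (γ : Policy κ m r) (k : Fin κ) :
    Measurable (N.control η γ k) :=
  (N.measurable_control_past η γ le_rfl).mono (N.past_le η k) le_rfl

lemma Noise.measurable_state_past (η : Signaling κ m) (γ : Policy κ m r) (k : Fin κ) :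
    Measurable[N.past η k] (N.state η γ k.castSucc) := by
  have : N.state η γ k.castSucc = fun s => N.freeState k.castSucc s
      + ∑ j ∈ Finset.Iio k, (M.A ^ ((k : ℕ) - (j : ℕ) - 1) * M.B) *ᵥ N.control η γ j s :=
    funext fun s => N.state_castSucc_eq η γ k s
  rw [this]
  refine measurable_add_vec (N.measurable_freeState_past η _ (by simp)) ?_
  exact Finset.measurable_sum _ fun j hj =>
    measurable_mulVec_comp (N.measurable_control_past η γ (Finset.mem_Iio.1 hj).le) _

lemma Noise.indepFun_noise {β : Type*} {mβ : MeasurableSpace β} (η : Signaling κ m) (k : Fin κ)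
    {Y : S → β} (hY : Measurable[N.past η k] Y) : IndepFun Y (N.w k) P := by
  have h : Indep (N.past η k)
      (⨆ i ∈ ({Sum.inr (Sum.inl k)} : Set (Unit ⊕ (Fin κ ⊕ Fin κ))),
        MeasurableSpace.comap (N.prim η i) inferInstance) P :=
    indep_iSup_of_disjoint (fun i => (N.measurable_prim η i).comap_le) (N.indep η)
      (Set.disjoint_singleton_right.2 fun h => h k le_rfl rfl)
  simp only [Set.mem_singleton_iff, iSup_iSup_eq_left] at h
  exact (IndepFun_iff_Indep _ _ _).2 (indep_of_indep_of_le_left h hY.comap_le)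

/-! ### Moments of the primitive random vectors and of the control-free state -/

section Gaussian

variable {C : Matrix (Fin m) (Fin m) ℝ} {X : S → Fin m → ℝ}

lemma memLp_two_of_hasLaw
    (h : HasLaw (fun s => WithLp.toLp 2 (X s)) (multivariateGaussian 0 C) P) : MemLp X 2 P := by
  refine MemLp.of_eval fun i => ?_
  have h1 : MemLp (id : EuclideanSpace ℝ (Fin m) → _) 2
      (P.map fun s => WithLp.toLp 2 (X s)) := by
    rw [h.map_eq]
    exact IsGaussian.memLp_two_id
  have h2 := (memLp_map_measure_iff h1.1 h.aemeasurable).1 h1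
  exact h2.eval_piLp i

lemma integral_eval_of_hasLaw
    (h : HasLaw (fun s => WithLp.toLp 2 (X s)) (multivariateGaussian 0 C) P) (i : Fin m) :
    ∫ s, X s i ∂P = 0 := by
  have h1 := h.integral_comp (f := fun x : EuclideanSpace ℝ (Fin m) => x i)
    (by fun_prop : Measurable fun x : EuclideanSpace ℝ (Fin m) => x i).aestronglyMeasurable
  have h2 : ∫ x, (EuclideanSpace.proj i : EuclideanSpace ℝ (Fin m) →L[ℝ] ℝ) x
      ∂(multivariateGaussian 0 C) = 0 := by
    rw [ContinuousLinearMap.integral_comp_id_comm IsGaussian.integrable_id]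
    simp
  exact h1.trans h2

lemma integral_mul_of_hasLaw (hC : C.PosSemidef)
    (h : HasLaw (fun s => WithLp.toLp 2 (X s)) (multivariateGaussian 0 C) P) (i j : Fin m) :
    C i j = ∫ s, X s i * X s j ∂P := by
  have : IsProbabilityMeasure P := h.isProbabilityMeasure
  have hX := memLp_two_of_hasLaw h
  have h1 := covariance_eq_sub (hX.eval i) (hX.eval j)
  rw [integral_eval_of_hasLaw h i, zero_mul, sub_zero] at h1
  rw [← covariance_eval_multivariateGaussian (μ := 0) hC i j, ← h.map_eq,
    covariance_map (by fun_prop) (by fun_prop) h.aemeasurable]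
  exact h1

end Gaussian

lemma Noise.memLp_w (k : Fin κ) : MemLp (N.w k) 2 P := memLp_two_of_hasLaw (N.law_w k)

lemma Noise.memLp_x₁ : MemLp N.x₁ 2 P := memLp_two_of_hasLaw N.law_x₁

lemma Noise.memLp_freeState (t : Fin (κ + 1)) : MemLp (N.freeState t) 2 P := by
  induction t using Fin.induction with
  | zero =>
    rw [show N.freeState 0 = N.x₁ from funext fun s => N.freeState_zero s]
    exact N.memLp_x₁
  | succ k ih =>
    have : N.freeState k.succ = fun s => M.A *ᵥ N.freeState k.castSucc s + N.w k s :=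
      funext fun s => N.freeState_succ k s
    rw [this]
    exact (memLp_mulVec ih M.A).add (N.memLp_w k)

end TrajectoryLemmas

/-! ### Second moments -/

section Moments

variable {S : Type*} {mS : MeasurableSpace S} {P : Measure S} {n : ℕ}

lemma integrable_quad {X : S → Fin n → ℝ} (hX : MemLp X 2 P) (W : Matrix (Fin n) (Fin n) ℝ) :
    Integrable (fun s => quad W (X s)) P :=
  integrable_dotProduct hX (memLp_mulVec hX W)

lemma integral_quad_add {X Y : S → Fin n → ℝ} (hX : MemLp X 2 P) (hY : MemLp Y 2 P)
    {W : Matrix (Fin n) (Fin n) ℝ} (hW : W.IsSymm) :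
    ∫ s, quad W (X s + Y s) ∂P = ∫ s, quad W (X s) ∂P + 2 * ∫ s, X s ⬝ᵥ (W *ᵥ Y s) ∂P
      + ∫ s, quad W (Y s) ∂P := by
  have h1 := integrable_quad hX W
  have h2 := (integrable_dotProduct hX (memLp_mulVec hY W)).const_mul 2
  have h3 := integrable_quad hY W
  simp_rw [quad_add hW]
  rw [integral_add (f := fun s => quad W (X s) + 2 * (X s ⬝ᵥ (W *ᵥ Y s))) (h1.add h2) h3,
    integral_add h1 h2, integral_const_mul]

lemma lintegral_quad {X : S → Fin n → ℝ} (hX : MemLp X 2 P) {W : Matrix (Fin n) (Fin n) ℝ}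
    (hW : W.PosSemidef) :
    ∫⁻ s, ENNReal.ofReal (quad W (X s)) ∂P = ENNReal.ofReal (∫ s, quad W (X s) ∂P) :=
  (ofReal_integral_eq_lintegral_ofReal (integrable_quad hX W)
    (.of_forall fun _ => quad_nonneg hW _)).symm

variable {κ m r : ℕ} {Ω : Type*} {M : Model κ m r Ω} [IsProbabilityMeasure P] (N : Noise M P)

lemma Noise.integral_freeState (t : Fin (κ + 1)) (i : Fin m) :
    ∫ s, N.freeState t s i ∂P = 0 := by
  induction t using Fin.induction generalizing i with
  | zero =>
    simp only [N.freeState_zero]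
    exact integral_eval_of_hasLaw N.law_x₁ i
  | succ k ih =>
    have hx : ∀ j, Integrable (fun s => N.freeState k.castSucc s j) P := fun j =>
      ((N.memLp_freeState k.castSucc).eval j).integrable (by norm_num)
    have hw : Integrable (fun s => N.w k s i) P :=
      ((N.memLp_w k).eval i).integrable (by norm_num)
    simp only [N.freeState_succ, Pi.add_apply, Matrix.mulVec, dotProduct]
    rw [integral_add (integrable_finsetSum _ fun j _ => (hx j).const_mul _) hw,
      integral_finsetSum _ fun j _ => (hx j).const_mul _,
      integral_eval_of_hasLaw (N.law_w k) i, add_zero]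
    exact Finset.sum_eq_zero fun j _ => by rw [integral_const_mul, ih, mul_zero]

lemma Noise.memLp_post (η : Signaling κ m) (k : Fin κ) : MemLp (N.post η k) 2 P :=
  memLp_condExp_pi _ (N.memLp_freeState _)

lemma Noise.integral_post (η : Signaling κ m) (k : Fin κ) (i : Fin m) :
    ∫ s, N.post η k s i ∂P = 0 := by
  have h := condExp_eval_ae (N.info η k) ((N.memLp_freeState k.castSucc).integrable
    (by norm_num)) i
  rw [← N.integral_freeState k.castSucc i,
    ← integral_condExp (N.info_le η k) (f := fun s => N.freeState k.castSucc s i)]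
  exact integral_congr_ae h

lemma Noise.H_apply (η : Signaling κ m) (k : Fin κ) (i j : Fin m) :
    N.H η k i j = ∫ s, N.post η k s i * N.post η k s j ∂P := by
  change cov[fun s => N.post η k s i, fun s => N.post η k s j; P] = _
  rw [covariance_eq_sub ((N.memLp_post η k).eval i) ((N.memLp_post η k).eval j),
    N.integral_post, zero_mul, sub_zero]
  rfl

lemma Noise.integral_post_dotProduct (η : Signaling κ m) (k : Fin κ)
    (W : Matrix (Fin m) (Fin m) ℝ) :
    ∫ s, N.post η k s ⬝ᵥ (W *ᵥ N.post η k s) ∂P = (N.H η k * W).trace :=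
  integral_dotProduct_mulVec_eq_trace (N.memLp_post η k) (N.H_apply η k) W

lemma Noise.integral_dotProduct_noise (η : Signaling κ m) (k : Fin κ) {Y : S → Fin n → ℝ}
    (hY : MemLp Y 2 P) (hYm : Measurable[N.past η k] Y) (W : Matrix (Fin n) (Fin m) ℝ) :
    ∫ s, Y s ⬝ᵥ (W *ᵥ N.w k s) ∂P = 0 := by
  have h := integral_dotProduct_of_indepFun (N.memLp_w k) (memLp_mulVec hY Wᵀ)
    (N.indepFun_noise η k (measurable_mulVec_comp hYm Wᵀ))
    (integral_eval_of_hasLaw (N.law_w k))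
  rw [← h]
  refine integral_congr_ae (.of_forall fun s => ?_)
  simp only
  rw [dotProduct_comm (Wᵀ *ᵥ Y s), dotProduct_transpose_mulVec, dotProduct_comm]

lemma Noise.integral_quad_noise (k : Fin κ) (W : Matrix (Fin m) (Fin m) ℝ) :
    ∫ s, quad W (N.w k s) ∂P = (W * M.covNoise).trace := by
  rw [Matrix.trace_mul_comm]
  exact integral_dotProduct_mulVec_eq_trace (N.memLp_w k)
    (integral_mul_of_hasLaw M.covNoise_posSemidef (N.law_w k)) W

lemma Noise.integral_quad_init (W : Matrix (Fin m) (Fin m) ℝ) :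
    ∫ s, quad W (N.x₁ s) ∂P = (W * M.covInit).trace := by
  rw [Matrix.trace_mul_comm]
  exact integral_dotProduct_mulVec_eq_trace N.memLp_x₁
    (integral_mul_of_hasLaw M.covInit_posSemidef N.law_x₁) W

lemma Noise.integral_quad_add_noise (η : Signaling κ m) (k : Fin κ) {Y : S → Fin m → ℝ}
    (hY : MemLp Y 2 P) (hYm : Measurable[N.past η k] Y) {W : Matrix (Fin m) (Fin m) ℝ}
    (hW : W.IsSymm) :
    ∫ s, quad W (Y s + N.w k s) ∂P = ∫ s, quad W (Y s) ∂P + (W * M.covNoise).trace := by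
  rw [integral_quad_add hY (N.memLp_w k) hW, N.integral_dotProduct_noise η k hY hYm,
    N.integral_quad_noise]
  ring

/-- Against functions of the information at stage `k`, the state at stage `k` may be replaced by
its posterior estimate. -/
lemma Noise.integral_dotProduct_freeState (η : Signaling κ m) (k : Fin κ) {Y : S → Fin n → ℝ}
    (hY : MemLp Y 2 P) (hYm : Measurable[N.info η k] Y) (W : Matrix (Fin n) (Fin m) ℝ) :
    ∫ s, Y s ⬝ᵥ (W *ᵥ N.freeState k.castSucc s) ∂P
      = ∫ s, Y s ⬝ᵥ (W *ᵥ N.post η k s) ∂P := by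
  have h := integral_dotProduct_condExp (N.info_le η k) (N.memLp_freeState k.castSucc)
    (memLp_mulVec hY Wᵀ) (measurable_mulVec_comp hYm Wᵀ)
  have h2 : ∀ y x, y ⬝ᵥ (W *ᵥ x) = (Wᵀ *ᵥ y) ⬝ᵥ x := fun y x => by
    rw [dotProduct_comm (Wᵀ *ᵥ y), dotProduct_transpose_mulVec, dotProduct_comm]
  simp only [h2]
  exact h

lemma Noise.integral_dotProduct_freeState_of_le (η : Signaling κ m) (k : Fin κ)
    (t : Fin (κ + 1)) (h : k.val ≤ t.val) {Y : S → Fin n → ℝ} (hY : MemLp Y 2 P)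
    (hYm : Measurable[N.info η k] Y) (W : Matrix (Fin n) (Fin m) ℝ) :
    ∫ s, Y s ⬝ᵥ (W *ᵥ N.freeState t s) ∂P
      = ∫ s, Y s ⬝ᵥ ((W * M.A ^ (t.val - k.val)) *ᵥ N.post η k s) ∂P := by
  induction t using Fin.induction generalizing W with
  | zero =>
    have hk : (0 : Fin (κ + 1)) = k.castSucc := by
      ext
      simpa using (Nat.le_zero.1 h).symm
    rw [hk, N.integral_dotProduct_freeState η k hY hYm]
    simp
  | succ l ih =>
    rcases Nat.lt_or_ge l.val k.val with hl | hl
    · have hk : l.succ = k.castSucc := by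
        ext
        simp only [Fin.val_succ, Fin.val_castSucc] at h ⊢
        omega
      rw [hk, N.integral_dotProduct_freeState η k hY hYm]
      simp
    · have he : l.succ.val - k.val = (l.castSucc.val - k.val) + 1 := by
        simp only [Fin.val_succ, Fin.val_castSucc]
        omega
      have hi := ih (by simpa using hl) (W * M.A)
      rw [he, pow_succ', ← Matrix.mul_assoc, ← hi]
      simp only [N.freeState_succ, Matrix.mulVec_add, dotProduct_add, Matrix.mulVec_mulVec]
      rw [integral_add (integrable_dotProduct hY (memLp_mulVec (N.memLp_freeState _) _))
        (integrable_dotProduct hY (memLp_mulVec (N.memLp_w l) _)),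
        N.integral_dotProduct_noise η l hY
          (hYm.mono (N.info_le_past η (Fin.le_def.2 hl)) le_rfl), add_zero]

lemma Noise.integral_post_dotProduct_post (η : Signaling κ m) {k l : Fin κ} (h : k ≤ l)
    (W : Matrix (Fin m) (Fin m) ℝ) :
    ∫ s, N.post η k s ⬝ᵥ (W *ᵥ N.post η l s) ∂P
      = (N.H η k * (W * M.A ^ (l.val - k.val))).trace := by
  rw [← N.integral_post_dotProduct, ← N.integral_dotProduct_freeState η l (N.memLp_post η k)
    (N.measurable_post_info η h), N.integral_dotProduct_freeState_of_le η k l.castSucc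
    (by simpa using h) (N.memLp_post η k) (N.measurable_post_info η le_rfl)]
  rfl

lemma integral_dotProduct_swap {k l : ℕ} (X : S → Fin k → ℝ) (Y : S → Fin l → ℝ)
    (W : Matrix (Fin k) (Fin l) ℝ) :
    ∫ s, X s ⬝ᵥ (W *ᵥ Y s) ∂P = ∫ s, Y s ⬝ᵥ (Wᵀ *ᵥ X s) ∂P := by
  refine integral_congr_ae (.of_forall fun s => ?_)
  simp only
  rw [dotProduct_transpose_mulVec, dotProduct_comm]

lemma Noise.H_isSymm (η : Signaling κ m) (k : Fin κ) : (N.H η k).IsSymm := by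
  ext i j
  rw [Matrix.transpose_apply, N.H_apply, N.H_apply]
  simp only [mul_comm]

lemma Noise.integral_post_dotProduct_post' (η : Signaling κ m) {k l : Fin κ} (h : k ≤ l)
    (W : Matrix (Fin m) (Fin m) ℝ) :
    ∫ s, N.post η l s ⬝ᵥ (W *ᵥ N.post η k s) ∂P
      = (N.H η k * ((M.A ^ (l.val - k.val))ᵀ * W)).trace := by
  rw [integral_dotProduct_swap, N.integral_post_dotProduct_post η h, ← Matrix.trace_transpose]
  rw [Matrix.transpose_mul, (N.H_isSymm η k).eq, Matrix.transpose_mul, Matrix.transpose_transpose,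
    Matrix.trace_mul_comm]

/-- The stacked posterior estimates. -/
def Noise.stackedPost (η : Signaling κ m) (s : S) : Fin κ × Fin m → ℝ :=
  Function.uncurry fun k => N.post η k s

lemma Noise.integral_stackedPost (η : Signaling κ m) (ω : Option Ω) :
    ∫ s, N.stackedPost η s ⬝ᵥ (M.V ω *ᵥ N.stackedPost η s) ∂P
      = ∑ k, (N.H η k * M.Xi ω k).trace := by
  have hint : ∀ k l, Integrable
      (fun s => N.post η k s ⬝ᵥ (block (M.V ω) k l *ᵥ N.post η l s)) P := fun k l =>
    integrable_dotProduct (N.memLp_post η k) (memLp_mulVec (N.memLp_post η l) _)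
  simp only [Noise.stackedPost, uncurry_dotProduct_mulVec]
  rw [integral_finsetSum _ fun k _ => integrable_finsetSum _ fun l _ => hint k l]
  simp_rw [integral_finsetSum _ fun l _ => hint _ l]
  rw [sum_sum_eq_diag_add_sum_Ioi]
  refine Finset.sum_congr rfl fun k _ => ?_
  rw [Model.Xi, Matrix.mul_add, Matrix.trace_add, Matrix.mul_sum, Matrix.trace_sum]
  congr 1
  · rw [N.integral_post_dotProduct]
  · refine Finset.sum_congr rfl fun l hl => ?_
    have hkl := (Finset.mem_Ioi.1 hl).le
    rw [N.integral_post_dotProduct_post η hkl, N.integral_post_dotProduct_post' η hkl,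
      Matrix.mul_add, Matrix.trace_add]

end Moments

/-! ### The controller's problem -/

section Controller

variable {S : Type*} {mS : MeasurableSpace S} {P : Measure S}
  {κ m r : ℕ} {Ω : Type*} {M : Model κ m r Ω} [IsProbabilityMeasure P] (N : Noise M P)

lemma Noise.memLp_state {η : Signaling κ m} {γ : Policy κ m r}
    (hu : ∀ k, MemLp (N.control η γ k) 2 P) (t : Fin (κ + 1)) :
    MemLp (N.state η γ t) 2 P := by
  rw [show N.state η γ t = fun s => _ from funext fun s => N.state_eq_freeState_add η γ t s]
  exact (N.memLp_freeState t).add (memLp_finset_sum _ fun j _ => memLp_mulVec (hu j) _)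

lemma Noise.memLp_freeControl {η : Signaling κ m} {γ : Policy κ m r} (ω : Option Ω)
    (hu : ∀ k, MemLp (N.control η γ k) 2 P) (k : Fin κ) :
    MemLp (N.freeControl ω η γ k) 2 P :=
  (hu k).add (memLp_finset_sum _ fun j _ => memLp_mulVec (hu j) _)

lemma Noise.measurable_freeControl_info (ω : Option Ω) (η : Signaling κ m) (γ : Policy κ m r)
    (k : Fin κ) : Measurable[N.info η k] (N.freeControl ω η γ k) :=
  measurable_add_vec (N.measurable_control_info η γ le_rfl)
    (Finset.measurable_sum _ fun _ hj =>
      measurable_mulVec_comp (N.measurable_control_info η γ (Finset.mem_Iio.1 hj).le) _)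

/-- If the transformed controls are square integrable, then so are the controls. -/
lemma Noise.memLp_control_of_freeControl {η : Signaling κ m} {γ : Policy κ m r} {ω : Option Ω}
    (h : ∀ k, MemLp (N.freeControl ω η γ k) 2 P) (k : Fin κ) :
    MemLp (N.control η γ k) 2 P := by
  induction k using WellFoundedLT.induction with
  | ind k ih =>
    have hs : MemLp (fun s => ∑ j ∈ Finset.Iio k,
        (M.K ω k * M.A ^ ((k : ℕ) - (j : ℕ) - 1) * M.B) *ᵥ N.control η γ j s) 2 P :=
      memLp_finset_sum _ fun j hj => memLp_mulVec (ih j (Finset.mem_Iio.1 hj)) _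
    have := (h k).sub hs
    refine (memLp_congr_ae (.of_forall fun s => ?_)).1 this
    simp [Noise.freeControl]

lemma Noise.control_add_state (ω : Option Ω) (η : Signaling κ m) (γ : Policy κ m r) (k : Fin κ)
    (s : S) :
    N.control η γ k s + M.K ω k *ᵥ N.state η γ k.castSucc s
      = N.freeControl ω η γ k s + M.K ω k *ᵥ N.freeState k.castSucc s := by
  rw [N.state_castSucc_eq, Noise.freeControl, Matrix.mulVec_add, Matrix.mulVec_sum]
  simp only [Matrix.mulVec_mulVec, Matrix.mul_assoc]
  abel

lemma Noise.integral_Qt_step {η : Signaling κ m} {γ : Policy κ m r} (ω : Option Ω)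
    (hu : ∀ k, MemLp (N.control η γ k) 2 P) (k : Fin κ) :
    ∫ s, quad (M.Qt ω (k + 1)) (N.state η γ k.succ s) ∂P
        + ∫ s, quad (M.R ω) (N.control η γ k s) ∂P
      = ∫ s, quad (M.Qt ω k - M.Q ω) (N.state η γ k.castSucc s) ∂P
        + (M.Qt ω (k + 1) * M.covNoise).trace
        + ∫ s, quad (M.Del ω k) (N.freeControl ω η γ k s
            + M.K ω k *ᵥ N.freeState k.castSucc s) ∂P := by
  have hx := N.memLp_state hu k.castSucc
  have hY : MemLp (fun s => M.A *ᵥ N.state η γ k.castSucc s + M.B *ᵥ N.control η γ k s) 2 P :=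
    (memLp_mulVec hx M.A).add (memLp_mulVec (hu k) M.B)
  have hYm : Measurable[N.past η k]
      fun s => M.A *ᵥ N.state η γ k.castSucc s + M.B *ᵥ N.control η γ k s :=
    measurable_add_vec (measurable_mulVec_comp (N.measurable_state_past η γ k) _)
      (measurable_mulVec_comp (N.measurable_control_past η γ le_rfl) _)
  have h1 := N.integral_quad_add_noise η k hY hYm
    (isSymm_of_posSemidef (M.Qt_posSemidef ω (k + 1)))
  have hd : MemLp (fun s => N.freeControl ω η γ k s + M.K ω k *ᵥ N.freeState k.castSucc s) 2 P :=
    (N.memLp_freeControl ω hu k).add (memLp_mulVec (N.memLp_freeState _) _)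
  simp only [N.state_succ]
  rw [h1, add_right_comm, ← integral_add (integrable_quad hY _) (integrable_quad (hu k) _),
    add_right_comm _ (Matrix.trace _), ← integral_add (integrable_quad hx _) (integrable_quad hd _)]
  congr 1
  refine integral_congr_ae (.of_forall fun s => ?_)
  simp only
  rw [M.quad_Qt_step, N.control_add_state]

/-- The part of the objective of type `ω` that no control policy can influence. -/
def Noise.minCost (ω : Option Ω) (η : Signaling κ m) : ℝ :=
  M.del0 ω + ∑ k : Fin κ, ∫ s, quad (M.Del ω k)
    (M.K ω k *ᵥ (N.freeState k.castSucc s - N.post η k s)) ∂P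

/-- The loss from deviating from the optimal control at stage `k`. -/
def Noise.excess (ω : Option Ω) (η : Signaling κ m) (γ : Policy κ m r) (k : Fin κ) : ℝ :=
  ∫ s, quad (M.Del ω k) (N.freeControl ω η γ k s + M.K ω k *ᵥ N.post η k s) ∂P

lemma Noise.excess_nonneg (ω : Option Ω) (η : Signaling κ m) (γ : Policy κ m r) (k : Fin κ) :
    0 ≤ N.excess ω η γ k :=
  integral_nonneg fun _ => quad_nonneg (M.Del_posDef ω k).posSemidef _

lemma Noise.integral_Del_split {η : Signaling κ m} {γ : Policy κ m r} (ω : Option Ω)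
    (hu : ∀ k, MemLp (N.control η γ k) 2 P) (k : Fin κ) :
    ∫ s, quad (M.Del ω k) (N.freeControl ω η γ k s + M.K ω k *ᵥ N.freeState k.castSucc s) ∂P
      = N.excess ω η γ k + ∫ s, quad (M.Del ω k)
          (M.K ω k *ᵥ (N.freeState k.castSucc s - N.post η k s)) ∂P := by
  have hx := N.memLp_freeState k.castSucc
  have hp := N.memLp_post η k
  have hY : MemLp (fun s => N.freeControl ω η γ k s + M.K ω k *ᵥ N.post η k s) 2 P :=
    (N.memLp_freeControl ω hu k).add (memLp_mulVec hp _)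
  have hYm : Measurable[N.info η k]
      fun s => N.freeControl ω η γ k s + M.K ω k *ᵥ N.post η k s :=
    measurable_add_vec (N.measurable_freeControl_info ω η γ k)
      (measurable_mulVec_comp (N.measurable_post_info η le_rfl) _)
  have hE : MemLp (fun s => M.K ω k *ᵥ (N.freeState k.castSucc s - N.post η k s)) 2 P :=
    memLp_mulVec (hx.sub hp) _
  have h1 := integral_quad_add hY hE (isSymm_of_posSemidef (M.Del_posDef ω k).posSemidef)
  have h2 : ∫ s, (N.freeControl ω η γ k s + M.K ω k *ᵥ N.post η k s) ⬝ᵥ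
      (M.Del ω k *ᵥ (M.K ω k *ᵥ (N.freeState k.castSucc s - N.post η k s))) ∂P = 0 := by
    simp only [Matrix.mulVec_sub, dotProduct_sub, Matrix.mulVec_mulVec]
    rw [integral_sub (integrable_dotProduct hY (memLp_mulVec hx _))
      (integrable_dotProduct hY (memLp_mulVec hp _)),
      N.integral_dotProduct_freeState η k hY hYm, sub_self]
  rw [h2, mul_zero, add_zero] at h1
  rw [Noise.excess, ← h1]
  refine integral_congr_ae (.of_forall fun s => ?_)
  simp only [Matrix.mulVec_sub]
  congr 1
  abel

lemma Noise.controllerCost_eq {η : Signaling κ m} {γ : Policy κ m r} (ω : Option Ω)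
    (hu : ∀ k, MemLp (N.control η γ k) 2 P) :
    N.controllerCost ω η γ = ENNReal.ofReal (N.minCost ω η + ∑ k, N.excess ω η γ k) ∧
      0 ≤ N.minCost ω η + ∑ k, N.excess ω η γ k := by
  set q : Fin κ → ℝ := fun k => ∫ s, quad (M.Q ω) (N.state η γ k.succ s) ∂P
    + ∫ s, quad (M.R ω) (N.control η γ k s) ∂P with hq
  have hQ0 : ∀ k : Fin κ, 0 ≤ ∫ s, quad (M.Q ω) (N.state η γ k.succ s) ∂P := fun k =>
    integral_nonneg fun _ => quad_nonneg (M.Q_posSemidef ω) _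
  have hR0 : ∀ k : Fin κ, 0 ≤ ∫ s, quad (M.R ω) (N.control η γ k s) ∂P := fun k =>
    integral_nonneg fun _ => quad_nonneg (M.R_posDef ω).posSemidef _
  have hq0 : ∀ k, 0 ≤ q k := fun k => add_nonneg (hQ0 k) (hR0 k)
  set g : Fin (κ + 1) → ℝ := fun t => ∫ s, quad (M.Qt ω t - M.Q ω) (N.state η γ t s) ∂P with hg
  have hstep : ∀ k : Fin κ, q k = g k.castSucc - g k.succ + (M.Qt ω (k + 1) * M.covNoise).trace
      + (N.excess ω η γ k + ∫ s, quad (M.Del ω k)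
          (M.K ω k *ᵥ (N.freeState k.castSucc s - N.post η k s)) ∂P) := fun k => by
    have h := N.integral_Qt_step ω hu k
    rw [N.integral_Del_split ω hu k] at h
    have h2 : g k.succ = ∫ s, quad (M.Qt ω (k + 1)) (N.state η γ k.succ s) ∂P
        - ∫ s, quad (M.Q ω) (N.state η γ k.succ s) ∂P := by
      simp only [hg, quad_sub_left, Fin.val_succ]
      exact integral_sub (integrable_quad (N.memLp_state hu _) _)
        (integrable_quad (N.memLp_state hu _) _)
    have h3 : g k.castSucc = ∫ s, quad (M.Qt ω k - M.Q ω) (N.state η γ k.castSucc s) ∂P := rfl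
    rw [h2, h3, hq]
    linarith
  have hlast : g (Fin.last κ) = 0 := by
    simp [hg, M.Qt_last, quad]
  have hzero : g 0 = ((M.Qt ω 0 - M.Q ω) * M.covInit).trace := by
    simp only [hg, N.state_zero, Fin.val_zero]
    exact N.integral_quad_init _
  have htel : ∑ k : Fin κ, (g k.castSucc - g k.succ) = g 0 - g (Fin.last κ) := by
    rw [Finset.sum_sub_distrib]
    linarith [Fin.sum_univ_succ g, Fin.sum_univ_castSucc g]
  have hsum : ∑ k, q k = N.minCost ω η + ∑ k, N.excess ω η γ k := by
    simp only [hstep, Finset.sum_add_distrib, htel, hlast, hzero, Noise.minCost, Model.del0]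
    ring
  refine ⟨?_, hsum ▸ Finset.sum_nonneg fun k _ => hq0 k⟩
  rw [← hsum, ENNReal.ofReal_sum_of_nonneg fun k _ => hq0 k, Noise.controllerCost]
  refine Finset.sum_congr rfl fun k _ => ?_
  rw [lintegral_quad (N.memLp_state hu _) (M.Q_posSemidef ω),
    lintegral_quad (hu k) (M.R_posDef ω).posSemidef, ← ENNReal.ofReal_add (hQ0 k) (hR0 k)]

lemma Noise.memLp_control_of_cost_lt_top {η : Signaling κ m} {γ : Policy κ m r} {ω : Option Ω}
    (h : N.controllerCost ω η γ < ∞) (k : Fin κ) : MemLp (N.control η γ k) 2 P := by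
  refine memLp_of_lintegral_quad_lt_top (M.R_posDef ω) (N.measurable_control η γ k) ?_
  have hk := ENNReal.sum_lt_top.1 h k (Finset.mem_univ k)
  exact (ENNReal.add_lt_top.1 hk).2

/-- The linear feedback condition that characterizes best responses. -/
def Noise.IsFeedback (ω : Option Ω) (η : Signaling κ m) (γ : Policy κ m r) : Prop :=
  ∀ k, N.freeControl ω η γ k =ᵐ[P] fun s => -(M.K ω k *ᵥ N.post η k s)

lemma Noise.IsFeedback.memLp_control {N : Noise M P} {ω : Option Ω} {η : Signaling κ m}
    {γ : Policy κ m r} (h : N.IsFeedback ω η γ) (k : Fin κ) : MemLp (N.control η γ k) 2 P :=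
  N.memLp_control_of_freeControl (ω := ω)
    (fun k => (memLp_congr_ae (h k)).2 (memLp_mulVec (N.memLp_post η k) _).neg) k

lemma Noise.excess_eq_zero_iff {ω : Option Ω} {η : Signaling κ m} {γ : Policy κ m r}
    (hu : ∀ k, MemLp (N.control η γ k) 2 P) (k : Fin κ) :
    N.excess ω η γ k = 0 ↔
      N.freeControl ω η γ k =ᵐ[P] fun s => -(M.K ω k *ᵥ N.post η k s) := by
  have hY : MemLp (fun s => N.freeControl ω η γ k s + M.K ω k *ᵥ N.post η k s) 2 P :=
    (N.memLp_freeControl ω hu k).add (memLp_mulVec (N.memLp_post η k) _)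
  rw [Noise.excess, integral_eq_zero_iff_of_nonneg
    (fun s => quad_nonneg (M.Del_posDef ω k).posSemidef _) (integrable_quad hY _)]
  refine Filter.eventually_congr (.of_forall fun s => ?_)
  simp only [Pi.zero_apply]
  rw [quad_eq_zero_iff (M.Del_posDef ω k), eq_neg_iff_add_eq_zero]

lemma Noise.IsFeedback.controllerCost {N : Noise M P} {ω : Option Ω} {η : Signaling κ m}
    {γ : Policy κ m r} (h : N.IsFeedback ω η γ) :
    N.controllerCost ω η γ = ENNReal.ofReal (N.minCost ω η) ∧ 0 ≤ N.minCost ω η := by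
  have hu := h.memLp_control
  have h0 : ∑ k, N.excess ω η γ k = 0 :=
    Finset.sum_eq_zero fun k _ => (N.excess_eq_zero_iff hu k).2 (h k)
  have := N.controllerCost_eq ω hu
  rwa [h0, add_zero] at this

lemma Noise.minCost_le (ω : Option Ω) (η : Signaling κ m) (γ : Policy κ m r) :
    ENNReal.ofReal (N.minCost ω η) ≤ N.controllerCost ω η γ := by
  rcases eq_or_lt_of_le (le_top : N.controllerCost ω η γ ≤ ∞) with h | h
  · rw [h]; exact le_top
  · rw [(N.controllerCost_eq ω (N.memLp_control_of_cost_lt_top h)).1]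
    exact ENNReal.ofReal_le_ofReal
      (le_add_of_nonneg_right (Finset.sum_nonneg fun k _ => N.excess_nonneg ω η γ k))

/-! ### Existence of best responses -/

/-- A policy built stage by stage from the earlier decisions. -/
lemma exists_policy_of_rec
    (F : (k : Fin κ) → ((j : Fin κ) → j < k → (Finset.Iic j → Fin m → ℝ) → Fin r → ℝ) →
      (Finset.Iic k → Fin m → ℝ) → Fin r → ℝ)
    (hF : ∀ k prev, (∀ j hj, Measurable (prev j hj)) → Measurable (F k prev)) :
    ∃ γ : Policy κ m r, ∀ k, γ.act k = F k fun j _ => γ.act j := by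
  let G : (k : Fin κ) → ((j : Fin κ) → j < k →
      {f : (Finset.Iic j → Fin m → ℝ) → Fin r → ℝ // Measurable f}) →
      {f : (Finset.Iic k → Fin m → ℝ) → Fin r → ℝ // Measurable f} := fun k prev =>
    ⟨F k fun j hj => (prev j hj).1, hF k _ fun j hj => (prev j hj).2⟩
  let a := WellFoundedLT.fix (α := Fin κ)
    (motive := fun k => {f : (Finset.Iic k → Fin m → ℝ) → Fin r → ℝ // Measurable f}) G
  refine ⟨⟨fun k => (a k).1, fun k => (a k).2⟩, fun k => ?_⟩
  exact congrArg Subtype.val (WellFoundedLT.fix_eq G k)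

/-- Restriction of the signals up to stage `k` to the signals up to stage `j`. -/
def restrictSignals {j k : Fin κ} (h : j ≤ k) (y : Finset.Iic k → Fin m → ℝ) :
    Finset.Iic j → Fin m → ℝ :=
  fun i => y ⟨i.1, Finset.mem_Iic.2 ((Finset.mem_Iic.1 i.2).trans h)⟩

lemma measurable_restrictSignals {j k : Fin κ} (h : j ≤ k) :
    Measurable (restrictSignals (m := m) h) :=
  measurable_of_forall_apply fun _ => measurable_pi_apply _

lemma Noise.restrictSignals_signals (η : Signaling κ m) (γ : Policy κ m r) {j k : Fin κ}
    (h : j ≤ k) (s : S) : restrictSignals h (N.signals η γ k s) = N.signals η γ j s := rfl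

/-- The earlier decisions, evaluated at the signals up to stage `k`, and `0` from stage `k` on. -/
def earlierControls (k : Fin κ)
    (prev : (j : Fin κ) → j < k → (Finset.Iic j → Fin m → ℝ) → Fin r → ℝ)
    (y : Finset.Iic k → Fin m → ℝ) (j : Fin κ) : Fin r → ℝ :=
  if h : j < k then prev j h (restrictSignals h.le y) else 0

lemma measurable_earlierControls (k : Fin κ)
    {prev : (j : Fin κ) → j < k → (Finset.Iic j → Fin m → ℝ) → Fin r → ℝ}
    (hp : ∀ j hj, Measurable (prev j hj)) (j : Fin κ) :
    Measurable fun y => earlierControls k prev y j := by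
  unfold earlierControls
  split_ifs with h
  · exact (hp j h).comp (measurable_restrictSignals h.le)
  · exact measurable_const

lemma Noise.earlierControls_signals (η : Signaling κ m) (γ : Policy κ m r) {j k : Fin κ}
    (h : j < k) (s : S) :
    earlierControls k (fun j _ => γ.act j) (N.signals η γ k s) j = N.control η γ j s := by
  rw [earlierControls, dif_pos h, N.restrictSignals_signals]
  rfl

lemma Noise.exists_isFeedback (ω : Option Ω) (η : Signaling κ m) :
    ∃ γ, N.IsFeedback ω η γ := by
  have hg : ∀ k, ∃ g : (Finset.Iic k → Fin m → ℝ) → Fin m → ℝ,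
      Measurable g ∧ N.post η k = g ∘ N.freeSignals η k := fun k =>
    (N.measurable_post_info η le_rfl).exists_eq_measurable_comp
  choose g hgm hg using hg
  obtain ⟨γ, hγ⟩ := exists_policy_of_rec (κ := κ) (m := m) (r := r)
    (fun k prev y =>
      -(M.K ω k *ᵥ g k fun i => y i - M.signalShift η i.1 (earlierControls k prev y))
        - ∑ j ∈ Finset.Iio k, (M.K ω k * M.A ^ ((k : ℕ) - (j : ℕ) - 1) * M.B) *ᵥ
            earlierControls k prev y j)
    (fun k prev hp => by
      refine measurable_sub_vec (Measurable.neg (measurable_mulVec_comp ((hgm k).comp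
        (measurable_of_forall_apply fun i => measurable_sub_vec (measurable_pi_apply i) ?_)) _))
        (Finset.measurable_sum _ fun j _ =>
          measurable_mulVec_comp (measurable_earlierControls k hp j) _)
      exact Model.measurable_signalShift η i.1 fun j _ => measurable_earlierControls k hp j)
  refine ⟨γ, fun k => .of_forall fun s => ?_⟩
  have hfree : (fun i : Finset.Iic k => N.signals η γ k s i - M.signalShift η i.1
      (earlierControls k (fun j _ => γ.act j) (N.signals η γ k s))) = N.freeSignals η k s := by
    ext1 i
    rw [N.signals_apply, N.signal_eq, N.freeSignals_apply, sub_eq_iff_eq_add, add_right_inj]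
    refine Model.signalShift_congr η i.1 fun j hj => ?_
    rw [N.earlierControls_signals η γ (hj.trans_le (Finset.mem_Iic.1 i.2))]
  have hc : N.control η γ k s = -(M.K ω k *ᵥ N.post η k s)
      - ∑ j ∈ Finset.Iio k, (M.K ω k * M.A ^ ((k : ℕ) - (j : ℕ) - 1) * M.B) *ᵥ
          N.control η γ j s := by
    rw [Noise.control, hγ k]
    simp only
    rw [hfree, hg k]
    congr 1
    refine Finset.sum_congr rfl fun j hj => ?_
    rw [N.earlierControls_signals η γ (Finset.mem_Iio.1 hj)]
  simp only [Noise.freeControl]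
  rw [hc, sub_add_cancel]

lemma Noise.isBestResponse_iff_isFeedback (ω : Option Ω) (η : Signaling κ m)
    (γ : Policy κ m r) : N.IsBestResponse ω η γ ↔ N.IsFeedback ω η γ := by
  refine ⟨fun h => ?_, fun h γ' => h.controllerCost.1 ▸ N.minCost_le ω η γ'⟩
  obtain ⟨γ₀, hγ₀⟩ := N.exists_isFeedback ω η
  have hle := h γ₀
  obtain ⟨h1, h2⟩ := hγ₀.controllerCost
  rw [h1] at hle
  have hu := N.memLp_control_of_cost_lt_top (hle.trans_lt ENNReal.ofReal_lt_top)
  rw [(N.controllerCost_eq ω hu).1, ENNReal.ofReal_le_ofReal_iff h2] at hle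
  have h0 : ∑ k, N.excess ω η γ k = 0 := le_antisymm (by linarith)
    (Finset.sum_nonneg fun k _ => N.excess_nonneg ω η γ k)
  intro k
  exact (N.excess_eq_zero_iff hu k).1 ((Finset.sum_eq_zero_iff_of_nonneg
    fun k _ => N.excess_nonneg ω η γ k).1 h0 k (Finset.mem_univ k))

end Controller

/-! ### The cost to the sensor -/

lemma ofBlocks_diagonal_mul {κ a b c : ℕ} (D : Fin κ → Matrix (Fin a) (Fin b) ℝ)
    (E : Fin κ → Matrix (Fin b) (Fin c) ℝ) :
    ofBlocks (Matrix.diagonal D) * ofBlocks (Matrix.diagonal E)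
      = ofBlocks (Matrix.diagonal fun k => D k * E k) := by
  refine Matrix.mulVec_injective (funext fun x => ?_)
  obtain ⟨X, rfl⟩ : ∃ X : Fin κ → Fin c → ℝ, x = Function.uncurry X :=
    ⟨Function.curry x, (Function.uncurry_curry x).symm⟩
  simp only [← Matrix.mulVec_mulVec, ofBlocks_diagonal_mulVec]

lemma ofBlocks_diagonal_transpose {κ a b : ℕ} (D : Fin κ → Matrix (Fin a) (Fin b) ℝ) :
    (ofBlocks (Matrix.diagonal D))ᵀ = ofBlocks (Matrix.diagonal fun k => (D k)ᵀ) := by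
  ext ⟨k, i⟩ ⟨l, j⟩
  rw [Matrix.transpose_apply, ofBlocks_apply, ofBlocks_apply]
  by_cases h : k = l
  · subst h; simp
  · simp [Matrix.diagonal_apply_ne _ h, Matrix.diagonal_apply_ne' _ h]

section Sensor

variable {S : Type*} {mS : MeasurableSpace S} {P : Measure S}
  {κ m r : ℕ} {Ω : Type*} {M : Model κ m r Ω} [IsProbabilityMeasure P] (N : Noise M P)

lemma Model.Xi_none (M : Model κ m r Ω) (k : Fin κ) :
    M.Xi none k = -((M.K none k)ᵀ * M.Del none k * M.K none k) := by
  have hV : M.V none = -ofBlocks (Matrix.diagonal fun k =>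
      (M.K none k)ᵀ * M.Del none k * M.K none k) := by
    rw [Model.V, Model.Kbar, Model.Delbar, ofBlocks_diagonal_transpose, ofBlocks_diagonal_mul,
      ofBlocks_diagonal_mul]
  have hb : ∀ k l, block (M.V none) k l = -(Matrix.diagonal (fun k =>
      (M.K none k)ᵀ * M.Del none k * M.K none k) k l) := fun k l => by rw [hV]; rfl
  rw [Model.Xi, hb, Matrix.diagonal_apply_eq, Finset.sum_eq_zero, add_zero]
  intro l hl
  have hkl := (Finset.mem_Ioi.1 hl).ne
  rw [hb, hb, Matrix.diagonal_apply_ne _ hkl, Matrix.diagonal_apply_ne' _ hkl]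
  simp

/-- The stacked control-free states. -/
def Noise.stackedFree (s : S) : Fin κ × Fin m → ℝ :=
  Function.uncurry fun k : Fin κ => N.freeState k.castSucc s

lemma memLp_uncurry {X : Fin κ → S → Fin m → ℝ} (hX : ∀ k, MemLp (X k) 2 P) :
    MemLp (fun s => Function.uncurry fun k => X k s) 2 P :=
  MemLp.of_eval fun a => (hX a.1).eval a.2

lemma Noise.trace_freeCov_mul (W : Matrix (Fin κ × Fin m) (Fin κ × Fin m) ℝ) :
    (N.freeCov * W).trace = ∫ s, N.stackedFree s ⬝ᵥ (W *ᵥ N.stackedFree s) ∂P :=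
  (integral_dotProduct_mulVec_eq_trace
    (memLp_uncurry fun k : Fin κ => N.memLp_freeState k.castSucc) (fun _ _ => rfl) W).symm

lemma Noise.integral_quad_error (η : Signaling κ m) (k : Fin κ) {W : Matrix (Fin m) (Fin m) ℝ}
    (hW : W.IsSymm) :
    ∫ s, quad W (N.freeState k.castSucc s - N.post η k s) ∂P
      = ∫ s, quad W (N.freeState k.castSucc s) ∂P - (N.H η k * W).trace := by
  have hx := N.memLp_freeState k.castSucc
  have hp := N.memLp_post η k
  have h1 := integral_quad_add hp (hx.sub hp) hW
  have h2 : ∫ s, N.post η k s ⬝ᵥ (W *ᵥ (N.freeState k.castSucc s - N.post η k s)) ∂P = 0 := by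
    simp only [Matrix.mulVec_sub, dotProduct_sub]
    rw [integral_sub (integrable_dotProduct hp (memLp_mulVec hx _))
      (integrable_dotProduct hp (memLp_mulVec hp _)),
      N.integral_dotProduct_freeState η k hp (N.measurable_post_info η le_rfl), sub_self]
  have h3 : ∫ s, quad W (N.post η k s) ∂P = (N.H η k * W).trace :=
    N.integral_post_dotProduct η k W
  simp only [Pi.sub_apply, h2, h3, add_sub_cancel] at h1
  linarith

lemma Noise.minCost_none (η : Signaling κ m) :
    N.minCost none η = N.xi none + ∑ k, (N.H η k * M.Xi none k).trace := by
  have hs : ∀ k, ((M.K none k)ᵀ * M.Del none k * M.K none k).IsSymm := fun k => by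
    rw [Matrix.IsSymm, Matrix.transpose_mul, Matrix.transpose_mul, Matrix.transpose_transpose,
      (isSymm_of_posSemidef (M.Del_posDef none k).posSemidef).eq, Matrix.mul_assoc]
  have hint : ∀ k : Fin κ, Integrable (fun s => N.freeState k.castSucc s ⬝ᵥ
      (M.Xi none k *ᵥ N.freeState k.castSucc s)) P := fun k =>
    integrable_quad (N.memLp_freeState k.castSucc) _
  rw [Noise.xi, N.trace_freeCov_mul]
  simp only [Noise.stackedFree, ofBlocks_diagonal_mulVec, uncurry_dotProduct]
  rw [integral_finsetSum _ fun k _ => hint k, Noise.minCost, sub_add, ← Finset.sum_sub_distrib,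
    sub_eq_add_neg, ← Finset.sum_neg_distrib]
  congr 1
  refine Finset.sum_congr rfl fun k _ => ?_
  simp only [quad_mulVec]
  rw [N.integral_quad_error η k (hs k), M.Xi_none]
  simp only [quad, Matrix.neg_mulVec, dotProduct_neg, integral_neg, Matrix.mul_neg,
    Matrix.trace_neg]
  ring

/-- The contribution of the controls to the state at stage `k + 1`. -/
def Noise.steer (η : Signaling κ m) (γ : Policy κ m r) (k : Fin κ) (s : S) : Fin m → ℝ :=
  ∑ j ∈ Finset.Iic k, (M.A ^ ((k : ℕ) - (j : ℕ)) * M.B) *ᵥ N.control η γ j s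

lemma Noise.memLp_steer {η : Signaling κ m} {γ : Policy κ m r}
    (hu : ∀ k, MemLp (N.control η γ k) 2 P) (k : Fin κ) : MemLp (N.steer η γ k) 2 P :=
  memLp_finset_sum _ fun j _ => memLp_mulVec (hu j) _

lemma Noise.measurable_steer (η : Signaling κ m) (γ : Policy κ m r) (k : Fin κ) :
    Measurable[N.info η k] (N.steer η γ k) :=
  Finset.measurable_sum _ fun _ hj =>
    measurable_mulVec_comp (N.measurable_control_info η γ (Finset.mem_Iic.1 hj)) _

lemma Noise.integral_quad_state {η : Signaling κ m} {γ : Policy κ m r}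
    (hu : ∀ k, MemLp (N.control η γ k) 2 P) (k : Fin κ) :
    ∫ s, quad (M.Q none) (N.state η γ k.succ s) ∂P
      = ∫ s, quad (M.Q none) (M.A *ᵥ N.freeState k.castSucc s) ∂P
        + (M.covNoise * M.Q none).trace
        + ∫ s, (quad (M.Q none) (N.steer η γ k s)
            + 2 * (N.steer η γ k s ⬝ᵥ (M.Q none *ᵥ (M.A *ᵥ N.post η k s)))) ∂P := by
  have hQ := isSymm_of_posSemidef (M.Q_posSemidef none)
  have hz := N.memLp_steer hu k
  have hAx := memLp_mulVec (N.memLp_freeState k.castSucc) M.A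
  have hAp := memLp_mulVec (N.memLp_post η k) M.A
  have hzm := N.measurable_steer η γ k
  have h1 := N.integral_quad_add_noise η k (hz.add hAx)
    (measurable_add_vec (hzm.mono (N.info_le_past η le_rfl) le_rfl)
      (measurable_mulVec_comp (N.measurable_freeState_past η k.castSucc (by simp)) _)) hQ
  have h2 := integral_quad_add hz hAx hQ
  have h3 := N.integral_dotProduct_freeState η k hz hzm (M.Q none * M.A)
  simp only [← Matrix.mulVec_mulVec] at h3
  have hstate : ∀ s, N.state η γ k.succ s
      = N.steer η γ k s + M.A *ᵥ N.freeState k.castSucc s + N.w k s := fun s => by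
    rw [N.state_succ_eq, N.freeState_succ, Noise.steer]
    abel
  simp only [hstate]
  simp only [Pi.add_apply] at h1
  rw [h1, h2, h3, integral_add (integrable_quad hz _)
    ((integrable_dotProduct hz (memLp_mulVec hAp _)).const_mul 2), integral_const_mul,
    Matrix.trace_mul_comm]
  ring

lemma Noise.IsFeedback.stacked_steer {N : Noise M P} {ω : Option Ω} {η : Signaling κ m}
    {γ : Policy κ m r} (h : N.IsFeedback ω η γ) :
    ∀ᵐ s ∂P, (Function.uncurry fun k => N.steer η γ k s) = -(M.T ω *ᵥ N.stackedPost η s) := by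
  filter_upwards [ae_all_iff.2 h] with s hs
  have h1 : M.Phi ω *ᵥ (Function.uncurry fun k => N.control η γ k s)
      = -(M.Kbar ω *ᵥ N.stackedPost η s) := by
    rw [M.Phi_mulVec, Model.Kbar, Noise.stackedPost, ofBlocks_diagonal_mulVec]
    ext ⟨k, i⟩
    exact congrFun (hs k) i
  have h2 : (Function.uncurry fun k => N.control η γ k s)
      = -((M.Phi ω)⁻¹ *ᵥ (M.Kbar ω *ᵥ N.stackedPost η s)) := by
    rw [← Matrix.mulVec_neg, ← h1, Matrix.mulVec_mulVec,
      Matrix.nonsing_inv_mul _ (M.isUnit_det_Phi ω), Matrix.one_mulVec]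
  have h3 := M.Z_mulVec fun k => N.control η γ k s
  rw [h2, Matrix.mulVec_neg] at h3
  rw [Model.T, ← Matrix.mulVec_mulVec, ← Matrix.mulVec_mulVec, h3]
  rfl

lemma Noise.trace_freeCov_Qbar :
    (N.freeCov * M.Abarᵀ * M.Qbar * M.Abar).trace
      = ∑ k : Fin κ, ∫ s, quad (M.Q none) (M.A *ᵥ N.freeState k.castSucc s) ∂P := by
  rw [Matrix.mul_assoc, Matrix.mul_assoc, N.trace_freeCov_mul, ← integral_finsetSum _ fun k _ =>
    integrable_quad (memLp_mulVec (N.memLp_freeState k.castSucc) M.A) _]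
  refine integral_congr_ae (.of_forall fun s => ?_)
  simp only
  rw [← Matrix.mulVec_mulVec, dotProduct_transpose_mulVec, ← Matrix.mulVec_mulVec,
    Noise.stackedFree, Model.Abar, Model.Qbar, one_kronecker_mulVec, one_kronecker_mulVec,
    uncurry_dotProduct]
  rfl

lemma Noise.IsFeedback.sum_integral_steer {N : Noise M P} {ω : Ω} {η : Signaling κ m}
    {γ : Policy κ m r} (h : N.IsFeedback (some ω) η γ) :
    ∑ k, ∫ s, (quad (M.Q none) (N.steer η γ k s)
        + 2 * (N.steer η γ k s ⬝ᵥ (M.Q none *ᵥ (M.A *ᵥ N.post η k s)))) ∂P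
      = ∑ k, (N.H η k * M.Xi (some ω) k).trace := by
  have hz := N.memLp_steer h.memLp_control
  have hint : ∀ k, Integrable (fun s => quad (M.Q none) (N.steer η γ k s)
      + 2 * (N.steer η γ k s ⬝ᵥ (M.Q none *ᵥ (M.A *ᵥ N.post η k s)))) P := fun k =>
    (integrable_quad (hz k) _).add ((integrable_dotProduct (hz k)
      (memLp_mulVec (memLp_mulVec (N.memLp_post η k) M.A) _)).const_mul 2)
  rw [← N.integral_stackedPost, ← integral_finsetSum _ fun k _ => hint k]
  refine integral_congr_ae ?_
  filter_upwards [h.stacked_steer] with s hs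
  set p := N.stackedPost η s with hp
  have h1 : ∑ k, quad (M.Q none) (N.steer η γ k s)
      = (M.T (some ω) *ᵥ p) ⬝ᵥ (M.Qbar *ᵥ (M.T (some ω) *ᵥ p)) := by
    have : (M.T (some ω) *ᵥ p) ⬝ᵥ (M.Qbar *ᵥ (M.T (some ω) *ᵥ p))
        = (-(M.T (some ω) *ᵥ p)) ⬝ᵥ (M.Qbar *ᵥ (-(M.T (some ω) *ᵥ p))) := by
      simp [Matrix.mulVec_neg]
    rw [this, ← hs, Model.Qbar, one_kronecker_mulVec, uncurry_dotProduct]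
    rfl
  have h2 : ∑ k, N.steer η γ k s ⬝ᵥ (M.Q none *ᵥ (M.A *ᵥ N.post η k s))
      = -((M.T (some ω) *ᵥ p) ⬝ᵥ (M.Qbar *ᵥ (M.Abar *ᵥ p))) := by
    rw [← neg_dotProduct, ← hs, hp, Noise.stackedPost, Model.Abar, Model.Qbar,
      one_kronecker_mulVec, one_kronecker_mulVec, uncurry_dotProduct]
  rw [Finset.sum_add_distrib, ← Finset.mul_sum, h1, h2]
  simp only [Model.V, Matrix.sub_mulVec, dotProduct_sub]
  simp only [Matrix.mul_assoc, ← Matrix.mulVec_mulVec, dotProduct_transpose_mulVec]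
  rw [dotProduct_mulVec_comm_of_isSymm M.Qbar_isSymm (M.Abar *ᵥ p)]
  ring

/-- The cost to the sensor of a best response, as an affine function of the posterior
covariances. -/
lemma Noise.IsFeedback.sensorCost {N : Noise M P} {ω : Option Ω} {η : Signaling κ m}
    {γ : Policy κ m r} (h : N.IsFeedback ω η γ) :
    N.sensorCost ω η γ = ENNReal.ofReal (N.xi ω + ∑ k, (N.H η k * M.Xi ω k).trace) ∧
      0 ≤ N.xi ω + ∑ k, (N.H η k * M.Xi ω k).trace := by
  cases ω with
  | none =>
    rw [← N.minCost_none]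
    exact h.controllerCost
  | some ω =>
    have hu := h.memLp_control
    have hsum : ∑ k : Fin κ, ∫ s, quad (M.Q none) (N.state η γ k.succ s) ∂P
        = N.xi (some ω) + ∑ k, (N.H η k * M.Xi (some ω) k).trace := by
      simp only [N.integral_quad_state hu, Finset.sum_add_distrib, h.sum_integral_steer,
        Noise.xi, N.trace_freeCov_Qbar]
      simp
    have h0 : ∀ k : Fin κ, 0 ≤ ∫ s, quad (M.Q none) (N.state η γ k.succ s) ∂P := fun k =>
      integral_nonneg fun _ => quad_nonneg (M.Q_posSemidef none) _
    rw [← hsum, ENNReal.ofReal_sum_of_nonneg fun k _ => h0 k]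
    refine ⟨?_, Finset.sum_nonneg fun k _ => h0 k⟩
    exact Finset.sum_congr rfl fun k _ =>
      lintegral_quad (N.memLp_state hu _) (M.Q_posSemidef none)

lemma Noise.sensorMean_eq [Fintype Ω] {η : Signaling κ m} {γ : Option Ω → Policy κ m r}
    (h : ∀ ω, N.IsFeedback ω η (γ ω)) {p : Option Ω → ℝ} (hp : p ∈ stdSimplex ℝ (Option Ω)) :
    N.sensorMean η γ p = ENNReal.ofReal (N.linearObjective (N.H η) p) ∧
      0 ≤ N.linearObjective (N.H η) p := by
  have h0 : ∀ ω, 0 ≤ p ω * (N.xi ω + ∑ k, (N.H η k * M.Xi ω k).trace) := fun ω =>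
    mul_nonneg (hp.1 ω) (h ω).sensorCost.2
  refine ⟨?_, Finset.sum_nonneg fun ω _ => h0 ω⟩
  rw [Noise.linearObjective, ENNReal.ofReal_sum_of_nonneg fun ω _ => h0 ω]
  refine Finset.sum_congr rfl fun ω _ => ?_
  rw [(h ω).sensorCost.1, ENNReal.ofReal_mul (hp.1 ω)]

lemma Noise.exists_isMaxOn_linearObjective [Fintype Ω] (H : Fin κ → Matrix (Fin m) (Fin m) ℝ) :
    ∃ p ∈ stdSimplex ℝ (Option Ω), ∀ q ∈ stdSimplex ℝ (Option Ω),
      N.linearObjective H q ≤ N.linearObjective H p := by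
  classical
  have hc : Continuous (N.linearObjective H) := by
    unfold Noise.linearObjective
    fun_prop
  exact (isCompact_stdSimplex ℝ (Option Ω)).exists_isMaxOn ⟨_, single_mem_stdSimplex ℝ none⟩
    hc.continuousOn

end Sensor

end RobustSensor

end

theorem lemma1 {κ m r : ℕ} {Ω : Type*} [Fintype Ω] (M : RobustSensor.Model κ m r Ω)
    {S : Type*} [MeasurableSpace S] (P : Measure S) [IsProbabilityMeasure P]
    (N : RobustSensor.Noise M P) :
    -- the matrices `Ξ_k^ω` are symmetric
    (∀ ω k, (M.Xi ω k).IsSymm) ∧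
    -- `H_k` does not depend on the control policy
    (∀ η γ k, N.posteriorCov η γ k = N.H η k) ∧
    -- best responses exist, and they are the policies with `u°_k = -K_k^ω E{x°_k | s_{1:k}}`
    (∀ ω η, ∃ γ, N.IsBestResponse ω η γ) ∧
    (∀ ω η γ, N.IsBestResponse ω η γ ↔
      ∀ k, N.freeControl ω η γ k =ᵐ[P] fun s => -(M.K ω k *ᵥ N.posterior η γ k s)) ∧
    -- the problem faced by the sensor, for every choice of best responses
    ∀ γ : RobustSensor.Signaling κ m → Option Ω → RobustSensor.Policy κ m r,
      (∀ η ω, N.IsBestResponse ω η (γ η ω)) →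
      -- equality of the objectives for every distribution over the types
      (∀ η, ∀ p ∈ stdSimplex ℝ (Option Ω),
        (N.sensorMean η (γ η) p : EReal) = (N.linearObjective (N.H η) p : EReal)) ∧
      -- equality of the worst cases, which are attained
      (∀ η, ∃ p ∈ stdSimplex ℝ (Option Ω),
        (∀ q ∈ stdSimplex ℝ (Option Ω),
          N.linearObjective (N.H η) q ≤ N.linearObjective (N.H η) p) ∧
        (N.sensorObjective η (γ η) : EReal) = (N.linearObjective (N.H η) p : EReal)) ∧
      -- same minimizers
      (∀ η, (∀ η', N.sensorObjective η (γ η) ≤ N.sensorObjective η' (γ η')) ↔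
        ∀ η', (⨆ p : stdSimplex ℝ (Option Ω), (N.linearObjective (N.H η) p : EReal)) ≤
          ⨆ p : stdSimplex ℝ (Option Ω), (N.linearObjective (N.H η') p : EReal)) ∧
      -- same value
      (⨅ η, (N.sensorObjective η (γ η) : EReal)) =
        ⨅ η, ⨆ p : stdSimplex ℝ (Option Ω), (N.linearObjective (N.H η) p : EReal) := by
  refine ⟨M.Xi_isSymm, fun η γ k => ?_, fun ω η => ?_, fun ω η γ => ?_, fun γ hγ => ?_⟩
  · rw [RobustSensor.Noise.posteriorCov, N.posterior_eq_post]
    rfl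
  · obtain ⟨γ, hγ⟩ := N.exists_isFeedback ω η
    exact ⟨γ, (N.isBestResponse_iff_isFeedback ω η γ).2 hγ⟩
  · simp only [N.posterior_eq_post]
    exact N.isBestResponse_iff_isFeedback ω η γ
  have hf : ∀ η ω, N.IsFeedback ω η (γ η ω) := fun η ω =>
    (N.isBestResponse_iff_isFeedback ω η _).1 (hγ η ω)
  have hmean := fun η (p : Option Ω → ℝ) (hp : p ∈ stdSimplex ℝ (Option Ω)) =>
    N.sensorMean_eq (hf η) hp
  have hmax : ∀ η, ∃ p ∈ stdSimplex ℝ (Option Ω),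
      (∀ q ∈ stdSimplex ℝ (Option Ω),
        N.linearObjective (N.H η) q ≤ N.linearObjective (N.H η) p) ∧
      (N.sensorObjective η (γ η) : EReal) = (N.linearObjective (N.H η) p : EReal) := fun η => by
    obtain ⟨p, hp, hpmax⟩ := N.exists_isMaxOn_linearObjective (N.H η)
    refine ⟨p, hp, hpmax, ?_⟩
    have : N.sensorObjective η (γ η) = ENNReal.ofReal (N.linearObjective (N.H η) p) := by
      refine le_antisymm (iSup_le fun q => ?_) ?_
      · rw [(hmean η q q.2).1]
        exact ENNReal.ofReal_le_ofReal (hpmax q q.2)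
      · rw [← (hmean η p hp).1]
        exact le_iSup (fun q : stdSimplex ℝ (Option Ω) => N.sensorMean η (γ η) q) ⟨p, hp⟩
    rw [this, EReal.coe_ennreal_ofReal, max_eq_left (hmean η p hp).2]
  have hobj : ∀ η, (N.sensorObjective η (γ η) : EReal)
      = ⨆ p : stdSimplex ℝ (Option Ω), (N.linearObjective (N.H η) p : EReal) := fun η => by
    obtain ⟨p, hp, hpmax, heq⟩ := hmax η
    rw [heq]
    exact le_antisymm
      (le_iSup (fun q : stdSimplex ℝ (Option Ω) => (N.linearObjective (N.H η) q : EReal)) ⟨p, hp⟩)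
      (iSup_le fun q => EReal.coe_le_coe_iff.2 (hpmax q q.2))
  refine ⟨fun η p hp => ?_, hmax, fun η => ?_, ?_⟩
  · rw [(hmean η p hp).1, EReal.coe_ennreal_ofReal, max_eq_left (hmean η p hp).2]
  · simp only [← hobj, EReal.coe_ennreal_le_coe_ennreal_iff]
  · simp only [hobj]
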